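/- Let $G=(V,E)$ be a finite connected undirected graph without self-loops or multiple edges, with unit edge weights, let $N(i)$ be the set of neighbours of $i\in V$, and let $\mathcal P(G)=\{\rho\in\mathbb R^V:\rho_i\ge 0,\ \sum_i\rho_i=1\}$. Let $\theta_{ij}(\rho)=\Theta(\rho_i,\rho_j)$, where $\Theta:[0,\infty)^2\to[0,\infty)$ is symmetric, continuous on $[0,\infty)^2$, $C^\infty$, positive and concave on $(0,\infty)^2$, and satisfies $\min(s,t)\le\Theta(s,t)\le\max(s,t)$ for $s,t\ge 0$. Let $W$ be a standard one-dimensional Brownian motion on a probability space, let $\delta>0$, and let $W^\delta$ be the piecewise linear interpolation of $W$ at the times $t_k=k\delta$, so that $\dot W^\delta(t)=(W(t_{k+1})-W(t_k))/\delta$ for $t\in[t_k,t_{k+1})$. All sums over $(i,j)\in E$ count each edge in both orientations. For $\rho^a,\rho^b\in\mathcal P(G)$ and a sample path of $W$, let $C_F(\rho^a,\rho^b)$ be the set of pairs $(\rho,m)$ with $\rho\in H^1([0,1];\mathcal P(G))$, $m\in L^2([0,1];\mathbb R^{V\times V})$ skew-symmetric, $\rho(0)=\rho^a$, $\rho(1)=\rho^b$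 and, for every $i\in V$ and a.e. $t\in[0,1]$, $$\dot\rho_i(t)+\sum_{j\in N(i)}m_{ij}(t)+\sum_{j\in N(i)}m_{ij}(t)\,\dot W^\delta(t)=0 .$$ Let $$\mathcal A(\rho,m)=\int_0^1\frac14\sum_{(i,j)\in E}L(\theta_{ij}(\rho),m_{ij})\,dt,$$ where $L(x,y)=y^2/x$ if $x>0$, $L(0,0)=0$, and $L(x,y)=\infty$ otherwise. Then, almost surely, for all $\rho^a,\rho^b\in\mathcal P(G)$, the minimum of $\mathcal A$ over $C_F(\rho^a,\rho^b)$ is attained and finite, and $$\min_{(\rho,m)\in C_F(\rho^a,\rho^b)}\mathcal A(\rho,m)=\sup_{S}\Big(\langle S(1),\rho^b\rangle-\langle S(0),\rho^a\rangle\Big),$$ where the supremum is over all $S\in H^1([0,1];\mathbb R^V)$ such that, for a.e. $t\in[0,1]$, $$\sup_{\rho\in\mathcal P(G)}\Big\{\langle\dot S(t),\rho\rangle+\frac14\sum_{(i,j)\in E}(S_i(t)-S_j(t))^2\,\theta_{ij}(\rho)\,(1+\dot W^\delta(t))^2\Big\}=0 .$$ -/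

import Mathlib

open MeasureTheory ProbabilityTheory Set
open scoped NNReal ENNReal

noncomputable section

namespace GraphOT

/-- The value at time `t ≥ 0` of the piecewise linear (Wong--Zakai) interpolation, with step `δ`,
of a path `w`: on `[kδ, (k+1)δ)` it is `w(kδ) + (t - kδ)/δ * (w((k+1)δ) - w(kδ))`. -/
def wongZakai (w : ℝ≥0 → ℝ) (δ : ℝ≥0) (t : ℝ) : ℝ :=
  w (⌊t / δ⌋₊ * δ) + (t - ⌊t / δ⌋₊ * δ) / δ * (w ((⌊t / δ⌋₊ + 1) * δ) - w (⌊t / δ⌋₊ * δ))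

/-- The time derivative of the Wong--Zakai interpolation: on `[kδ, (k+1)δ)` it is the difference
quotient `(w((k+1)δ) - w(kδ)) / δ`. -/
def wongZakaiDeriv (w : ℝ≥0 → ℝ) (δ : ℝ≥0) (t : ℝ) : ℝ :=
  (w ((⌊t / δ⌋₊ + 1) * δ) - w (⌊t / δ⌋₊ * δ)) / δ

/-- `wongZakaiDeriv` is indeed the (right) derivative of `wongZakai` at every time. -/
theorem hasDerivWithinAt_wongZakai (w : ℝ≥0 → ℝ) {δ : ℝ≥0} (hδ : 0 < δ) {t : ℝ} (ht : 0 ≤ t) :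
    HasDerivWithinAt (wongZakai w δ) (wongZakaiDeriv w δ t) (Ici t) t := by
  have hδ' : (0 : ℝ) < δ := by exact_mod_cast hδ
  set k := ⌊t / δ⌋₊ with hk
  have h1 : t < (k + 1) * δ := by
    have := Nat.lt_floor_add_one (t / (δ : ℝ))
    rwa [div_lt_iff₀ hδ'] at this
  have h2 : (k : ℝ) ≤ t / δ := Nat.floor_le (by positivity)
  have h3 : HasDerivAt
      (fun s : ℝ => w (k * δ) + (s - k * δ) / δ * (w ((k + 1) * δ) - w (k * δ)))
      (wongZakaiDeriv w δ t) t := by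
    have := (((hasDerivAt_id t).sub_const ((k : ℝ) * δ)).div_const (δ : ℝ)).mul_const
      (w ((k + 1) * δ) - w (k * δ))
    have := this.const_add (w (k * δ))
    refine this.congr_deriv ?_
    simp only [wongZakaiDeriv, ← hk]
    ring
  refine h3.hasDerivWithinAt.congr_of_eventuallyEq ?_ ?_
  · have : Ico t ((k + 1) * δ) ∈ nhdsWithin t (Ici t) := Ico_mem_nhdsGE h1
    filter_upwards [this] with s hs
    have : ⌊s / (δ : ℝ)⌋₊ = k := by
      rw [Nat.floor_eq_iff (div_nonneg (ht.trans hs.1) hδ'.le)]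
      refine ⟨h2.trans (by gcongr; exact hs.1), ?_⟩
      rw [div_lt_iff₀ hδ']
      exact hs.2
    simp only [wongZakai, this]
  · simp only [wongZakai, ← hk]

/-- The admissible functions `Θ` defining the density dependent edge weights
`θ_ij(ρ) = Θ(ρ_i, ρ_j)`. -/
structure IsProbWeight (Θ : ℝ → ℝ → ℝ) : Prop where
  smooth : ContDiffOn ℝ ((⊤ : ℕ∞) : WithTop ℕ∞) (fun p : ℝ × ℝ => Θ p.1 p.2) (Ioi 0 ×ˢ Ioi 0)
  cont : ContinuousOn (fun p : ℝ × ℝ => Θ p.1 p.2) (Ici 0 ×ˢ Ici 0)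
  symm : ∀ s t, 0 ≤ s → 0 ≤ t → Θ s t = Θ t s
  pos : ∀ s t, 0 < s → 0 < t → 0 < Θ s t
  min_le : ∀ s t, 0 ≤ s → 0 ≤ t → min s t ≤ Θ s t
  le_max : ∀ s t, 0 ≤ s → 0 ≤ t → Θ s t ≤ max s t
  concave : ConcaveOn ℝ (Ioi 0 ×ˢ Ioi 0) (fun p : ℝ × ℝ => Θ p.1 p.2)

/-- `f ∈ H¹([0,1]; ℝ^V)` with weak derivative `f'`, where `f` is the continuous representative:
`f' ∈ L²` and `f` is the indefinite integral of `f'` on `[0,1]`. -/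
structure HasH1Deriv {V : Type*} [Fintype V] (f f' : ℝ → V → ℝ) : Prop where
  memLp : MemLp f' 2 (volume.restrict (Icc (0 : ℝ) 1))
  eq_integral : ∀ t ∈ Icc (0 : ℝ) 1, f t = f 0 + ∫ s in (0 : ℝ)..t, f' s

/-- The function `L(x,y) = y²/x` if `x > 0`, `L(0,0) = 0`, and `L(x,y) = ∞` otherwise. -/
def edgeCost (x y : ℝ) : ℝ≥0∞ :=
  if 0 < x then ENNReal.ofReal (y ^ 2 / x) else if x = 0 ∧ y = 0 then 0 else ⊤

section

variable {V : Type*} [Fintype V] (G : SimpleGraph V) [DecidableRel G.Adj]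

/-- The action `∫₀¹ ¼ ∑_{(i,j) ∈ E} L(θ_ij(ρ), m_ij) dt`, each edge being counted in both
orientations. -/
def action (Θ : ℝ → ℝ → ℝ) (ρ : ℝ → V → ℝ) (m : ℝ → V → V → ℝ) : ℝ≥0∞ :=
  ∫⁻ t in Icc (0 : ℝ) 1,
    (1 / 4) * ∑ i, ∑ j ∈ G.neighborFinset i, edgeCost (Θ (ρ t i) (ρ t j)) (m t i j)

/-- `(ρ, m)` lies in the feasible set `C_F(ρᵃ, ρᵇ)`: `ρ ∈ H¹([0,1]; 𝒫(G))` joins `ρᵃ` to `ρᵇ`,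
`m` is a square integrable path of skew-symmetric matrices, and
`ρ_i' + ∑_{j ∈ N(i)} m_ij + (∑_{j ∈ N(i)} m_ij) wdot = 0` almost everywhere. -/
structure IsFeasible (wdot : ℝ → ℝ) (ρa ρb : V → ℝ) (ρ : ℝ → V → ℝ) (m : ℝ → V → V → ℝ) :
    Prop where
  mem_simplex : ∀ t ∈ Icc (0 : ℝ) 1, ρ t ∈ stdSimplex ℝ V
  init : ρ 0 = ρa
  final : ρ 1 = ρb
  memLp : ∀ i j, MemLp (fun t => m t i j) 2 (volume.restrict (Icc (0 : ℝ) 1))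
  skew : ∀ᵐ t ∂volume.restrict (Icc (0 : ℝ) 1), ∀ i j, m t i j = - m t j i
  continuity : ∃ ρ' : ℝ → V → ℝ, HasH1Deriv ρ ρ' ∧
    ∀ᵐ t ∂volume.restrict (Icc (0 : ℝ) 1), ∀ i,
      ρ' t i + ∑ j ∈ G.neighborFinset i, m t i j
        + (∑ j ∈ G.neighborFinset i, m t i j) * wdot t = 0

/-- `⟨a, r⟩ + ¼ ∑_{(i,j) ∈ E} (s_i - s_j)² θ_ij(r) (1 + x)²`, each edge being counted in both
orientations. -/
def hamiltonJacobi (Θ : ℝ → ℝ → ℝ) (x : ℝ) (a s r : V → ℝ) : ℝ :=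
  ∑ i, a i * r i +
    (1 / 4) * ∑ i, ∑ j ∈ G.neighborFinset i, (s i - s j) ^ 2 * Θ (r i) (r j) * (1 + x) ^ 2

/-- `S ∈ H¹([0,1]; ℝ^V)`, with derivative `S'`, is admissible in the dual problem: for almost every
`t` the supremum of `hamiltonJacobi` over `r ∈ 𝒫(G)` is `0`. -/
structure IsDualAdmissible (Θ : ℝ → ℝ → ℝ) (wdot : ℝ → ℝ) (S S' : ℝ → V → ℝ) : Prop where
  h1 : HasH1Deriv S S'
  isLUB : ∀ᵐ t ∂volume.restrict (Icc (0 : ℝ) 1),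
    IsLUB ((fun r => hamiltonJacobi G Θ (wdot t) (S' t) (S t) r) '' stdSimplex ℝ V) 0

/-- The values of the action on the feasible set. -/
def actionValues (Θ : ℝ → ℝ → ℝ) (wdot : ℝ → ℝ) (ρa ρb : V → ℝ) : Set ℝ≥0∞ :=
  {x | ∃ ρ m, IsFeasible G wdot ρa ρb ρ m ∧ x = action G Θ ρ m}

/-- The values `⟨S(1), ρᵇ⟩ - ⟨S(0), ρᵃ⟩` over all dual admissible `S`. -/
def dualValues (Θ : ℝ → ℝ → ℝ) (wdot : ℝ → ℝ) (ρa ρb : V → ℝ) : Set ℝ :=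
  {x | ∃ S S', IsDualAdmissible G Θ wdot S S' ∧ x = ∑ i, S 1 i * ρb i - ∑ i, S 0 i * ρa i}

end

end GraphOT

end

/-! Put c = 1 + Ẇ^δ. Replacing the flux m by n = c m turns the continuity equation into ρ' + div n =
0 and moves the noise into the energy as the weight 1/c². This is reversible when c does not vanish.
Almost surely it does not: c takes finitely many values on [0,1], and an increment of Brownian
motion is a nondegenerate Gaussian, so it almost surely avoids -δ (`ae_one_add_quotient_ne_zero`).
Hence |c| lies between two positive constants on [0,1], and the rest is the deterministic theorem
`isLeast_action_and_isLUB_dual`.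

In the variables (ρ, n) the energy is convex, because `edgeCost` is a supremum of affine functions
nonincreasing in the weight and Θ is concave; it is also lower semicontinuous and coercive in L².
The integrated constraint ρ + ∫₀ᵗ div n = ρᵃ, with its terminal condition, is a bounded linear
equation T x = y₀. So the epigraph of y ↦ inf {A x | T x = y} is convex and closed, which gives a
minimizer, and Hahn-Banach strictly separates from it the point ε below the minimum
(`exists_min_and_dual_functional`). Finite feasibility makes the hyperplane nonvertical, so no
constraint qualification is needed. The multipliers are only ε-optimal, which suffices for a
supremum. Feasibility comes from an explicit path (`exists_controlled_finite_energy`).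

By Riesz representation and the adjoint of the Volterra operator, a multiplier is an H¹ potential S.
It need not be admissible, but its Lagrangian bound holds for every path of finite energy. Testing
it with a measurable near-maximizer r(t) of the Hamiltonian and the flux -c²(S_i - S_j)θ_ij(r)
bounds the dual value by means of the integral of h(t), the maximal Hamiltonian. Subtracting ∫₀ᵗ h
from S makes the maximum zero at a loss of at most ε (`exists_dualValue_of_lagrangian_bound`). The
opposite inequality is integration by parts and Young's inequality on each edge
(`ofReal_dual_le_action`). -/

namespace GraphOT

/-! ### Convex duality in Hilbert space -/

/-- A decreasing sequence of nonempty bounded closed convex sets in a Hilbert space has a common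
point. -/
theorem nonempty_iInter_of_closed_convex {X : Type*} [NormedAddCommGroup X]
    [InnerProductSpace ℝ X] [CompleteSpace X] {C : ℕ → Set X} (hanti : Antitone C)
    (hclosed : ∀ n, IsClosed (C n)) (hconv : ∀ n, Convex ℝ (C n)) (hne : ∀ n, (C n).Nonempty)
    (hbdd : Bornology.IsBounded (C 0)) : (⋂ n, C n).Nonempty := by
  -- Take v to be the projection of the origin onto C n. Its variational inequality controls
  -- distances by increments of the squared norm; these norms are monotone and bounded, so the
  -- projections form a Cauchy sequence.
  have key : ∀ n, ∃ v ∈ C n, ∀ w ∈ C n, ‖w - v‖ ^ 2 ≤ ‖w‖ ^ 2 - ‖v‖ ^ 2 := by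
    intro n
    obtain ⟨v, hv, hmin⟩ := exists_norm_eq_iInf_of_complete_convex (hne n)
      (hclosed n).isComplete (hconv n) 0
    refine ⟨v, hv, fun w hw => ?_⟩
    have h := (norm_eq_iInf_iff_real_inner_le_zero (hconv n) hv).1 hmin w hw
    rw [zero_sub, inner_neg_left, inner_sub_right, real_inner_self_eq_norm_sq] at h
    rw [norm_sub_sq_real, real_inner_comm]
    linarith
  choose v hv hvmin using key
  have hmono : Monotone fun n => ‖v n‖ ^ 2 := by
    intro n m hnm
    have := hvmin n (v m) (hanti hnm (hv m))
    have h0 := sq_nonneg ‖v m - v n‖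
    simp only
    linarith
  obtain ⟨R, hR⟩ := hbdd.exists_norm_le
  have hbound : BddAbove (range fun n => ‖v n‖ ^ 2) := by
    refine ⟨R ^ 2, ?_⟩
    rintro _ ⟨n, rfl⟩
    have := hR (v n) (hanti (Nat.zero_le n) (hv n))
    simp only
    gcongr
  have hlim := tendsto_atTop_ciSup hmono hbound
  set M := ⨆ n, ‖v n‖ ^ 2
  have hle : ∀ n, ‖v n‖ ^ 2 ≤ M := fun n => le_ciSup hbound n
  have hcauchy : CauchySeq v := by
    refine cauchySeq_of_le_tendsto_0' (fun n => √(M - ‖v n‖ ^ 2)) (fun n m hnm => ?_) ?_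
    · rw [dist_comm, dist_eq_norm]
      refine Real.le_sqrt_of_sq_le ?_
      have := hvmin n (v m) (hanti hnm (hv m))
      have := hle m
      linarith
    · rw [← Real.sqrt_zero]
      refine (Real.continuous_sqrt.tendsto 0).comp ?_
      have h1 : Filter.Tendsto (fun n => M - ‖v n‖ ^ 2) Filter.atTop (nhds 0) := by
        simpa using hlim.const_sub M
      exact h1
  obtain ⟨x, hx⟩ := cauchySeq_tendsto_of_complete hcauchy
  refine ⟨x, mem_iInter.2 fun n => (hclosed n).mem_of_tendsto hx ?_⟩
  filter_upwards [Filter.eventually_ge_atTop n] with m hm using hanti hm (hv m)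

section Duality

variable {X Y : Type*} [NormedAddCommGroup X] [InnerProductSpace ℝ X]
  [NormedAddCommGroup Y] [NormedSpace ℝ Y]

/-- The epigraph of the marginal function `y ↦ inf {A x | T x = y}`. -/
def marginalEpigraph (A : X → ℝ≥0∞) (T : X →L[ℝ] Y) : Set (Y × ℝ) :=
  {p | 0 ≤ p.2 ∧ ∃ x, T x = p.1 ∧ A x ≤ ENNReal.ofReal p.2}

theorem convex_sublevel {A : X → ℝ≥0∞}
    (hA : ∀ x y, ∀ a b : ℝ≥0, a + b = 1 → A (a • x + b • y) ≤ a * A x + b * A y) (r : ℝ≥0∞) :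
    Convex ℝ {x | A x ≤ r} := by
  intro x hx y hy a b ha hb hab
  lift a to ℝ≥0 using ha
  lift b to ℝ≥0 using hb
  have hab' : a + b = 1 := by exact_mod_cast hab
  refine (hA x y a b hab').trans ?_
  calc (a : ℝ≥0∞) * A x + b * A y ≤ a * r + b * r := by gcongr <;> assumption
    _ = r := by rw [← add_mul, ← ENNReal.coe_add, hab', ENNReal.coe_one, one_mul]

theorem convex_marginalEpigraph {A : X → ℝ≥0∞}
    (hA : ∀ x y, ∀ a b : ℝ≥0, a + b = 1 → A (a • x + b • y) ≤ a * A x + b * A y)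
    (T : X →L[ℝ] Y) : Convex ℝ (marginalEpigraph A T) := by
  rintro p ⟨hp0, x, hx, hxA⟩ q ⟨hq0, y, hy, hyA⟩ a b ha hb hab
  lift a to ℝ≥0 using ha
  lift b to ℝ≥0 using hb
  have hab' : a + b = 1 := by exact_mod_cast hab
  refine ⟨?_, a • x + b • y, ?_, ?_⟩
  · simp only [Prod.snd_add, Prod.smul_snd, smul_eq_mul]
    positivity
  · rw [map_add, NNReal.smul_def, NNReal.smul_def, map_smul, map_smul, hx, hy]
    rfl
  · refine (hA x y a b hab').trans ?_
    simp only [Prod.snd_add, Prod.smul_snd, smul_eq_mul]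
    rw [ENNReal.ofReal_add (by positivity) (by positivity), ENNReal.ofReal_mul a.coe_nonneg,
      ENNReal.ofReal_mul b.coe_nonneg, ENNReal.ofReal_coe_nnreal, ENNReal.ofReal_coe_nnreal]
    gcongr

/-- Near a limit point there are approximate solutions whose constraint error and excess cost are at
most 1/(n+1). They form decreasing closed convex bounded sets, and a common point solves the limit
problem exactly. This replaces weak compactness. -/
theorem isClosed_marginalEpigraph [CompleteSpace X] {A : X → ℝ≥0∞}
    (hA : ∀ x y, ∀ a b : ℝ≥0, a + b = 1 → A (a • x + b • y) ≤ a * A x + b * A y)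
    (hclosed : ∀ r : ℝ≥0, IsClosed {x | A x ≤ r})
    (hbdd : ∀ r : ℝ≥0, Bornology.IsBounded {x | A x ≤ r})
    (T : X →L[ℝ] Y) : IsClosed (marginalEpigraph A T) := by
  refine isClosed_of_closure_subset fun p hp => ?_
  have hp0 : 0 ≤ p.2 := by
    have : closure (marginalEpigraph A T) ⊆ {q : Y × ℝ | 0 ≤ q.2} :=
      closure_minimal (fun q hq => hq.1) (isClosed_le continuous_const continuous_snd)
    exact this hp
  let C : ℕ → Set X := fun n =>
    {x | ‖T x - p.1‖ ≤ 1 / ((n : ℝ) + 1)} ∩ {x | A x ≤ (p.2 + 1 / ((n : ℝ) + 1)).toNNReal}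
  have hC : (⋂ n, C n).Nonempty := by
    refine nonempty_iInter_of_closed_convex ?_ ?_ ?_ ?_ ?_
    · intro n m hnm x hx
      have h : 1 / ((m : ℝ) + 1) ≤ 1 / ((n : ℝ) + 1) := Nat.one_div_le_one_div hnm
      refine ⟨le_trans hx.1 h, le_trans (mem_ofPred_eq ▸ hx.2) ?_⟩
      gcongr
    · intro n
      exact (isClosed_le (by fun_prop) continuous_const).inter (hclosed _)
    · intro n
      refine Convex.inter ?_ (convex_sublevel hA _)
      have : {x | ‖T x - p.1‖ ≤ 1 / ((n : ℝ) + 1)}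
          = T ⁻¹' (Metric.closedBall p.1 (1 / ((n : ℝ) + 1))) := by
        ext x; simp [dist_eq_norm]
      rw [this]
      exact (convex_closedBall _ _).linear_preimage (T : X →ₗ[ℝ] Y)
    · intro n
      obtain ⟨q, ⟨hq0, x, hx, hxA⟩, hq⟩ := Metric.mem_closure_iff.1 hp (1 / ((n : ℝ) + 1))
        (by positivity)
      rw [dist_comm, Prod.dist_eq, max_lt_iff] at hq
      refine ⟨x, ?_, hxA.trans ?_⟩
      · rw [mem_ofPred_eq, hx, ← dist_eq_norm]
        exact hq.1.le
      · have := (abs_lt.1 hq.2).2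
        rw [ENNReal.ofReal]
        gcongr
        linarith
    · exact (hbdd _).subset inter_subset_right
  obtain ⟨x, hx⟩ := hC
  rw [mem_iInter] at hx
  have hlim : Filter.Tendsto (fun n : ℕ => 1 / ((n : ℝ) + 1)) Filter.atTop (nhds 0) :=
    tendsto_one_div_add_atTop_nhds_zero_nat
  refine ⟨hp0, x, ?_, ?_⟩
  · have : ‖T x - p.1‖ ≤ 0 := ge_of_tendsto' hlim fun n => (hx n).1
    rwa [norm_le_zero_iff, sub_eq_zero] at this
  · have h1 : Filter.Tendsto (fun n : ℕ => ENNReal.ofReal (p.2 + 1 / ((n : ℝ) + 1)))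
        Filter.atTop (nhds (ENNReal.ofReal p.2)) := by
      refine (ENNReal.continuous_ofReal.tendsto _).comp ?_
      simpa using hlim.const_add p.2
    exact ge_of_tendsto' h1 fun n => (hx n).2

/-- Fenchel duality for a convex functional with closed bounded sublevel sets on a Hilbert space
under a linear constraint: the minimum is attained, and it is approximated from below by
dual functionals. -/
theorem exists_min_and_dual_functional [CompleteSpace X] {A : X → ℝ≥0∞}
    (hA : ∀ x y, ∀ a b : ℝ≥0, a + b = 1 → A (a • x + b • y) ≤ a * A x + b * A y)
    (hclosed : ∀ r : ℝ≥0, IsClosed {x | A x ≤ r})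
    (hbdd : ∀ r : ℝ≥0, Bornology.IsBounded {x | A x ≤ r})
    (T : X →L[ℝ] Y) {y₀ : Y} (hne : ∃ x, T x = y₀ ∧ A x ≠ ⊤) :
    ∃ a : ℝ≥0, (∃ x, T x = y₀ ∧ A x = a) ∧ ∀ ε > 0, ∃ f : Y →L[ℝ] ℝ, ∀ x, A x ≠ ⊤ →
      (a : ℝ) - ε ≤ f (T x - y₀) + (A x).toReal := by
  have hcl := isClosed_marginalEpigraph hA hclosed hbdd T
  let s : Set ℝ := {r | (y₀, r) ∈ marginalEpigraph A T}
  have hs_closed : IsClosed s := hcl.preimage (by fun_prop)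
  have hs_bdd : BddBelow s := ⟨0, fun r hr => hr.1⟩
  have hs_ne : s.Nonempty := by
    obtain ⟨x, hx, hxA⟩ := hne
    exact ⟨(A x).toReal, ENNReal.toReal_nonneg, x, hx, by rw [ENNReal.ofReal_toReal hxA]⟩
  obtain ⟨h0, x, hx, hxA⟩ := hs_closed.csInf_mem hs_ne hs_bdd
  have hfin : A x ≠ ⊤ := ne_top_of_le_ne_top ENNReal.ofReal_ne_top hxA
  have hge : sInf s ≤ (A x).toReal :=
    csInf_le hs_bdd ⟨ENNReal.toReal_nonneg, x, hx, by rw [ENNReal.ofReal_toReal hfin]⟩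
  have hAx : A x = ENNReal.ofReal (sInf s) := by
    refine le_antisymm hxA ?_
    rw [← ENNReal.ofReal_toReal hfin]
    exact ENNReal.ofReal_le_ofReal hge
  refine ⟨(sInf s).toNNReal, ⟨x, hx, hAx⟩, fun ε hε => ?_⟩
  rw [Real.coe_toNNReal _ h0]
  have hnot : ((y₀, sInf s - ε) : Y × ℝ) ∉ marginalEpigraph A T := by
    intro h
    have := csInf_le hs_bdd (show sInf s - ε ∈ s from h)
    linarith
  obtain ⟨f, u, hfu, hf⟩ :=
    geometric_hahn_banach_point_closed (convex_marginalEpigraph hA T) hcl hnot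
  have hsplit : ∀ (y : Y) (r : ℝ), f (y, r) = f (y, 0) + r * f (0, 1) := by
    intro y r
    have : ((y, r) : Y × ℝ) = (y, 0) + r • (0, 1) := by simp
    rw [this, map_add, map_smul, smul_eq_mul]
  set l := f (0, 1) with hl
  -- The separated point lies directly below a point of the epigraph, so the two values of f differ
  -- by ε * l and l cannot be zero or negative.
  have hl_pos : 0 < l := by
    have h1 := hfu.trans (hf (y₀, sInf s) ⟨h0, x, hx, hxA⟩)
    rw [hsplit, hsplit y₀ (sInf s)] at h1
    nlinarith
  refine ⟨l⁻¹ • (f.comp (ContinuousLinearMap.inl ℝ Y ℝ)), fun z hz => ?_⟩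
  have h1 := hfu.trans (hf (T z, (A z).toReal)
    ⟨ENNReal.toReal_nonneg, z, rfl, by rw [ENNReal.ofReal_toReal hz]⟩)
  rw [hsplit, hsplit (T z)] at h1
  have h2 : (l⁻¹ • (f.comp (ContinuousLinearMap.inl ℝ Y ℝ))) (T z - y₀)
      = l⁻¹ * (f (T z, 0) - f (y₀, 0)) := by
    simp only [map_sub, smul_apply, ContinuousLinearMap.comp_apply,
      ContinuousLinearMap.inl_apply, smul_eq_mul]
    ring
  rw [h2]
  have h3 : l⁻¹ * (f (y₀, 0) + (sInf s - ε) * l) ≤ l⁻¹ * (f (T z, 0) + (A z).toReal * l) := by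
    gcongr
  have h4 : ∀ r : ℝ, l⁻¹ * (r * l) = r := fun r => by field_simp
  rw [mul_add, mul_add, h4, h4] at h3
  linarith

end Duality

/-! ### Calculus of primitives on the unit interval -/

/-- Lebesgue measure on the unit interval. -/
noncomputable abbrev unitVolume : Measure ℝ := volume.restrict (Icc (0 : ℝ) 1)

instance isProbabilityMeasure_unitVolume : IsProbabilityMeasure unitVolume := ⟨by simp⟩

theorem integral_unitVolume (f : ℝ → ℝ) : ∫ t, f t ∂unitVolume = ∫ t in (0 : ℝ)..1, f t := by
  rw [intervalIntegral.integral_of_le zero_le_one, integral_Icc_eq_integral_Ioc]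

theorem intervalIntegrable_of_integrable {f : ℝ → ℝ} (hf : Integrable f unitVolume) {a b : ℝ}
    (ha : a ∈ Icc (0 : ℝ) 1) (hb : b ∈ Icc (0 : ℝ) 1) : IntervalIntegrable f volume a b :=
  (IntegrableOn.mono_set hf (uIcc_subset_Icc ha hb)).intervalIntegrable

theorem integrable_of_memLp {f : ℝ → ℝ} (hf : MemLp f 2 unitVolume) : Integrable f unitVolume :=
  hf.integrable one_le_two

theorem continuousOn_primitive_unit {f : ℝ → ℝ} (hf : Integrable f unitVolume) :
    ContinuousOn (fun t => ∫ s in (0 : ℝ)..t, f s) (Icc 0 1) := by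
  have := intervalIntegral.continuousOn_primitive_interval (μ := volume) (f := f) (a := 0) (b := 1)
    (by rw [uIcc_of_le zero_le_one]; exact hf)
  rwa [uIcc_of_le zero_le_one] at this

/-- A real function on `[0,1]` with integrable weak derivative, as a single pair of functions. -/
structure IsPrimitive (f f' : ℝ → ℝ) : Prop where
  integrable : Integrable f' unitVolume
  eq_integral : ∀ t ∈ Icc (0 : ℝ) 1, f t = f 0 + ∫ s in (0 : ℝ)..t, f' s

theorem IsPrimitive.continuousOn {f f' : ℝ → ℝ} (h : IsPrimitive f f') :
    ContinuousOn f (Icc 0 1) :=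
  ((continuousOn_primitive_unit h.integrable).const_add (f 0)).congr h.eq_integral

theorem IsPrimitive.exists_bound {f f' : ℝ → ℝ} (h : IsPrimitive f f') :
    ∃ C, ∀ t ∈ Icc (0 : ℝ) 1, |f t| ≤ C :=
  isCompact_Icc.exists_bound_of_continuousOn h.continuousOn

theorem IsPrimitive.aestronglyMeasurable {f f' : ℝ → ℝ} (h : IsPrimitive f f') :
    AEStronglyMeasurable f unitVolume :=
  h.continuousOn.aestronglyMeasurable measurableSet_Icc

theorem IsPrimitive.memLp {f f' : ℝ → ℝ} (h : IsPrimitive f f') : MemLp f 2 unitVolume := by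
  obtain ⟨C, hC⟩ := h.exists_bound
  refine MemLp.of_bound h.aestronglyMeasurable C ?_
  filter_upwards [ae_restrict_mem measurableSet_Icc] with t ht using hC t ht

theorem IsPrimitive.integrable_mul {f f' g : ℝ → ℝ} (h : IsPrimitive f f')
    (hg : Integrable g unitVolume) : Integrable (fun t => f t * g t) unitVolume := by
  obtain ⟨C, hC⟩ := h.exists_bound
  refine hg.bdd_mul (c := C) h.aestronglyMeasurable ?_
  filter_upwards [ae_restrict_mem measurableSet_Icc] with t ht using hC t ht

theorem IsPrimitive.absolutelyContinuousOnInterval {f f' : ℝ → ℝ} (h : IsPrimitive f f') :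
    AbsolutelyContinuousOnInterval (fun t => f 0 + ∫ s in (0 : ℝ)..t, f' s) 0 1 := by
  have h1 : LipschitzOnWith 0 (fun _ : ℝ => f 0) (uIcc 0 1) := (LipschitzWith.const _).lipschitzOnWith
  exact h1.absolutelyContinuousOnInterval.fun_add
    ((intervalIntegrable_of_integrable h.integrable (by simp) (by simp)
      ).absolutelyContinuousOnInterval_intervalIntegral (by simp))

/-- Integration by parts on `[0,1]` for primitives of integrable functions. -/
theorem IsPrimitive.integral_by_parts {f f' g g' : ℝ → ℝ} (hf : IsPrimitive f f')
    (hg : IsPrimitive g g') :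
    ∫ t, (f' t * g t + f t * g' t) ∂unitVolume = f 1 * g 1 - f 0 * g 0 := by
  have h := AbsolutelyContinuousOnInterval.integral_deriv_mul_eq_sub
    hf.absolutelyContinuousOnInterval hg.absolutelyContinuousOnInterval
  have h1 : (1 : ℝ) ∈ Icc (0 : ℝ) 1 := by simp
  rw [← hf.eq_integral 1 h1, ← hg.eq_integral 1 h1] at h
  simp only [intervalIntegral.integral_same, add_zero] at h
  rw [← h, integral_unitVolume]
  refine intervalIntegral.integral_congr_ae ?_
  have hf1 := (intervalIntegrable_of_integrable hf.integrable (a := 0) (b := 1)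
    (by simp) (by simp)).ae_hasDerivAt_integral
  have hg1 := (intervalIntegrable_of_integrable hg.integrable (a := 0) (b := 1)
    (by simp) (by simp)).ae_hasDerivAt_integral
  filter_upwards [hf1, hg1] with t hft hgt ht
  have ht' : t ∈ uIcc (0 : ℝ) 1 := uIoc_subset_uIcc ht
  have ht'' : t ∈ Icc (0 : ℝ) 1 := by rwa [uIcc_of_le zero_le_one] at ht'
  have d1 := ((hft ht' 0 (by simp)).const_add (f 0)).deriv
  have d2 := ((hgt ht' 0 (by simp)).const_add (g 0)).deriv
  rw [d1, d2, ← hf.eq_integral t ht'', ← hg.eq_integral t ht'']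

theorem isPrimitive_intervalIntegral {f' : ℝ → ℝ} (h : Integrable f' unitVolume) (c : ℝ) :
    IsPrimitive (fun t => c + ∫ s in (0 : ℝ)..t, f' s) f' :=
  ⟨h, fun t _ => by simp⟩

theorem HasH1Deriv.isPrimitive {V : Type*} [Fintype V] {f f' : ℝ → V → ℝ} (h : HasH1Deriv f f')
    (i : V) : IsPrimitive (fun t => f t i) (fun t => f' t i) := by
  have hint : Integrable f' unitVolume := h.memLp.integrable one_le_two
  refine ⟨hint.eval i, fun t ht => ?_⟩
  have h1 := congrFun (h.eq_integral t ht) i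
  rw [h1, Pi.add_apply]
  congr 1
  rw [intervalIntegral.integral_of_le ht.1, intervalIntegral.integral_of_le ht.1]
  refine eval_integral (fun j => ?_) i
  exact (IntegrableOn.mono_set (hint.eval j) (Ioc_subset_Icc_self.trans (Icc_subset_Icc_right ht.2)))

theorem hasH1Deriv_of_isPrimitive {V : Type*} [Fintype V] {f f' : ℝ → V → ℝ}
    (hf : ∀ i, IsPrimitive (fun t => f t i) (fun t => f' t i))
    (hf' : ∀ i, MemLp (fun t => f' t i) 2 unitVolume) : HasH1Deriv f f' := by
  refine ⟨MemLp.of_eval hf', fun t ht => funext fun i => ?_⟩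
  rw [(hf i).eq_integral t ht, Pi.add_apply]
  congr 1
  rw [intervalIntegral.integral_of_le ht.1, intervalIntegral.integral_of_le ht.1]
  refine (eval_integral (fun j => ?_) i).symm
  exact (IntegrableOn.mono_set (hf j).integrable
    (Ioc_subset_Icc_self.trans (Icc_subset_Icc_right ht.2)))

/-! ### The Volterra operator on L² -/

section Volterra

theorem norm_intervalIntegral_le_norm_Lp (g : Lp ℝ 2 unitVolume) {t : ℝ}
    (ht : t ∈ Icc (0 : ℝ) 1) : ‖∫ s in (0 : ℝ)..t, g s‖ ≤ ‖g‖ := by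
  have hint : Integrable g unitVolume := integrable_of_memLp (Lp.memLp g)
  calc ‖∫ s in (0 : ℝ)..t, g s‖ ≤ ∫ s in (0 : ℝ)..t, ‖g s‖ :=
        intervalIntegral.norm_integral_le_integral_norm ht.1
    _ = ∫ s in Ioc 0 t, ‖g s‖ := intervalIntegral.integral_of_le ht.1
    _ ≤ ∫ s, ‖g s‖ ∂unitVolume := by
        refine setIntegral_mono_set hint.norm (ae_of_all _ fun s => norm_nonneg _) ?_
        exact (Ioc_subset_Icc_self.trans (Icc_subset_Icc_right ht.2)).eventuallyLE
    _ = (eLpNorm g 1 unitVolume).toReal := by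
        rw [integral_norm_eq_lintegral_enorm hint.aestronglyMeasurable, eLpNorm_one_eq_lintegral_enorm]
    _ ≤ ‖g‖ := by
        rw [Lp.norm_def]
        exact ENNReal.toReal_mono (Lp.memLp g).eLpNorm_ne_top
          (eLpNorm_le_eLpNorm_of_exponent_le one_le_two hint.aestronglyMeasurable)

theorem memLp_intervalIntegral (g : Lp ℝ 2 unitVolume) :
    MemLp (fun t => ∫ s in (0 : ℝ)..t, g s) 2 unitVolume := by
  have := (isPrimitive_intervalIntegral (integrable_of_memLp (Lp.memLp g)) 0).memLp
  simpa using this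

theorem intervalIntegral_Lp_add (g h : Lp ℝ 2 unitVolume) {t : ℝ} (ht : t ∈ Icc (0 : ℝ) 1) :
    ∫ s in (0 : ℝ)..t, (g + h : Lp ℝ 2 unitVolume) s
      = (∫ s in (0 : ℝ)..t, g s) + ∫ s in (0 : ℝ)..t, h s := by
  have h0 : (0 : ℝ) ∈ Icc (0 : ℝ) 1 := by simp
  rw [← intervalIntegral.integral_add
    (intervalIntegrable_of_integrable (integrable_of_memLp (Lp.memLp g)) h0 ht)
    (intervalIntegrable_of_integrable (integrable_of_memLp (Lp.memLp h)) h0 ht),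
    intervalIntegral.integral_of_le ht.1, intervalIntegral.integral_of_le ht.1]
  refine setIntegral_congr_ae measurableSet_Ioc ?_
  filter_upwards [(ae_restrict_iff' measurableSet_Icc).1 (Lp.coeFn_add g h)] with s hs hst
  exact hs (Icc_subset_Icc_right ht.2 (Ioc_subset_Icc_self hst))

theorem intervalIntegral_Lp_smul (c : ℝ) (g : Lp ℝ 2 unitVolume) {t : ℝ}
    (ht : t ∈ Icc (0 : ℝ) 1) :
    ∫ s in (0 : ℝ)..t, (c • g : Lp ℝ 2 unitVolume) s = c * ∫ s in (0 : ℝ)..t, g s := by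
  rw [← intervalIntegral.integral_const_mul, intervalIntegral.integral_of_le ht.1,
    intervalIntegral.integral_of_le ht.1]
  refine setIntegral_congr_ae measurableSet_Ioc ?_
  filter_upwards [(ae_restrict_iff' measurableSet_Icc).1 (Lp.coeFn_smul c g)] with s hs hst
  exact hs (Icc_subset_Icc_right ht.2 (Ioc_subset_Icc_self hst))

/-- The Volterra operator `g ↦ ∫₀ᵗ g` on `L²([0,1])`. -/
noncomputable def volterra : Lp ℝ 2 unitVolume →L[ℝ] Lp ℝ 2 unitVolume :=
  LinearMap.mkContinuous
    { toFun := fun g => (memLp_intervalIntegral g).toLp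
      map_add' := fun g h => by
        rw [← MemLp.toLp_add, MemLp.toLp_eq_toLp_iff]
        filter_upwards [ae_restrict_mem measurableSet_Icc] with t ht
        exact intervalIntegral_Lp_add g h ht
      map_smul' := fun c g => by
        rw [RingHom.id_apply, ← MemLp.toLp_const_smul, MemLp.toLp_eq_toLp_iff]
        filter_upwards [ae_restrict_mem measurableSet_Icc] with t ht
        exact intervalIntegral_Lp_smul c g ht } 1 fun g => by
    have h : ∀ᵐ t ∂unitVolume, ‖(memLp_intervalIntegral g).toLp _ t‖ ≤ ‖g‖ := by
      filter_upwards [MemLp.coeFn_toLp (memLp_intervalIntegral g),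
        ae_restrict_mem measurableSet_Icc] with t h1 ht
      rw [h1]
      exact norm_intervalIntegral_le_norm_Lp g ht
    have := Lp.norm_le_of_ae_bound (norm_nonneg _) h
    simpa [measureUnivNNReal] using this

theorem coeFn_volterra (g : Lp ℝ 2 unitVolume) :
    volterra g =ᵐ[unitVolume] fun t => ∫ s in (0 : ℝ)..t, g s :=
  MemLp.coeFn_toLp (memLp_intervalIntegral g)

/-- The functional `g ↦ ∫₀¹ g` on `L²([0,1])`. -/
noncomputable def unitIntegral : Lp ℝ 2 unitVolume →L[ℝ] ℝ :=
  LinearMap.mkContinuous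
    { toFun := fun g => ∫ s in (0 : ℝ)..1, g s
      map_add' := fun g h => intervalIntegral_Lp_add g h (by simp)
      map_smul' := fun c g => intervalIntegral_Lp_smul c g (by simp) } 1 fun g => by
    simpa using norm_intervalIntegral_le_norm_Lp g (t := 1) (by simp)

theorem unitIntegral_apply (g : Lp ℝ 2 unitVolume) :
    unitIntegral g = ∫ s in (0 : ℝ)..1, g s := rfl

/-- The adjoint of the Volterra operator integrates from the right end. -/
theorem inner_volterra (z g : Lp ℝ 2 unitVolume) :
    inner ℝ z (volterra g)
      = ∫ t, ((∫ s in (0 : ℝ)..1, z s) - ∫ s in (0 : ℝ)..t, z s) * g t ∂unitVolume := by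
  have hz := isPrimitive_intervalIntegral (integrable_of_memLp (Lp.memLp z)) 0
  have hg := isPrimitive_intervalIntegral (integrable_of_memLp (Lp.memLp g)) 0
  have hparts := hz.integral_by_parts hg
  simp only [zero_add, intervalIntegral.integral_same, mul_zero, sub_zero] at hparts hz hg
  have i1 : Integrable (fun t => z t * ∫ s in (0 : ℝ)..t, g s) unitVolume := by
    simpa only [mul_comm] using hg.integrable_mul hz.integrable
  have i2 : Integrable (fun t => (∫ s in (0 : ℝ)..t, z s) * g t) unitVolume :=
    hz.integrable_mul hg.integrable
  rw [integral_add i1 i2] at hparts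
  have e1 : inner ℝ z (volterra g) = ∫ t, z t * (∫ s in (0 : ℝ)..t, g s) ∂unitVolume := by
    rw [L2.inner_def]
    refine integral_congr_ae ?_
    filter_upwards [coeFn_volterra g] with t ht
    rw [ht]
    simp [mul_comm]
  have e2 : ∫ t, ((∫ s in (0 : ℝ)..1, z s) - ∫ s in (0 : ℝ)..t, z s) * g t ∂unitVolume
      = (∫ s in (0 : ℝ)..1, z s) * (∫ s in (0 : ℝ)..1, g s)
        - ∫ t, (∫ s in (0 : ℝ)..t, z s) * g t ∂unitVolume := by
    simp only [sub_mul]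
    rw [integral_sub (hg.integrable.const_mul _) i2, integral_const_mul,
      integral_unitVolume (fun t => g t)]
  rw [e1, e2]
  linarith

end Volterra

/-- Extending by the endpoint values gives a representative continuous on the whole line, hence
Borel; the measurable selection of maximizers relies on this. -/
theorem IsPrimitive.comp_projIcc {f f' : ℝ → ℝ} (h : IsPrimitive f f') :
    IsPrimitive (fun t => f (projIcc (0 : ℝ) 1 zero_le_one t)) f' := by
  refine ⟨h.integrable, fun t ht => ?_⟩
  rw [projIcc_of_mem zero_le_one ht, projIcc_left]
  exact h.eq_integral t ht

theorem IsPrimitive.continuous_comp_projIcc {f f' : ℝ → ℝ} (h : IsPrimitive f f') :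
    Continuous (fun t => f (projIcc (0 : ℝ) 1 zero_le_one t)) :=
  h.continuousOn.comp_continuous (continuous_subtype_val.comp continuous_projIcc)
    fun _ => Subtype.coe_prop _

theorem intervalIntegral_congr_unitVolume {f g : ℝ → ℝ} (h : f =ᵐ[unitVolume] g) {t : ℝ}
    (ht : t ∈ Icc (0 : ℝ) 1) : ∫ s in (0 : ℝ)..t, f s = ∫ s in (0 : ℝ)..t, g s := by
  rw [intervalIntegral.integral_of_le ht.1, intervalIntegral.integral_of_le ht.1]
  refine setIntegral_congr_ae measurableSet_Ioc ?_
  filter_upwards [(ae_restrict_iff' measurableSet_Icc).1 h] with s hs hst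
  exact hs (Icc_subset_Icc_right ht.2 (Ioc_subset_Icc_self hst))

theorem lintegral_integrand_congr {E : Type*} {ℓ : ℝ → E → ℝ≥0∞} {x y : ℝ → E} (hxy : x =ᵐ[unitVolume] y) :
    ∫⁻ t, ℓ t (x t) ∂unitVolume = ∫⁻ t, ℓ t (y t) ∂unitVolume := by
  refine lintegral_congr_ae ?_
  filter_upwards [hxy] with t ht
  rw [ht]

/-- The Riesz representation of a functional on `(V → L²) × (V → ℝ)`. -/
theorem exists_riesz_representation {V : Type*} [Fintype V]
    (f : (V → Lp ℝ 2 unitVolume) × (V → ℝ) →L[ℝ] ℝ) :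
    ∃ (z : V → Lp ℝ 2 unitVolume) (c : V → ℝ), ∀ y w,
      f (y, w) = ∑ i, inner ℝ (z i) (y i) + ∑ i, c i * w i := by
  classical
  refine ⟨fun i => (InnerProductSpace.toDual ℝ (Lp ℝ 2 unitVolume)).symm
    ((f.comp (ContinuousLinearMap.inl ℝ _ _)).comp
      (ContinuousLinearMap.single ℝ (fun _ : V => Lp ℝ 2 unitVolume) i)),
    fun i => f (0, Pi.single i 1), fun y w => ?_⟩
  simp only [InnerProductSpace.toDual_symm_apply]
  have h1 : ((y, w) : (V → Lp ℝ 2 unitVolume) × (V → ℝ))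
      = ∑ i, ContinuousLinearMap.inl ℝ _ _ (Pi.single i (y i))
        + ∑ i, w i • ((0 : V → Lp ℝ 2 unitVolume), (Pi.single i 1 : V → ℝ)) := by
    rw [← map_sum, Finset.univ_sum_single]
    refine Prod.ext ?_ ?_
    · simp [Prod.fst_sum]
    · ext i
      simp [Prod.snd_sum, Finset.sum_apply, Pi.single_apply]
  rw [h1, map_add, map_sum, map_sum]
  simp only [map_smul, smul_eq_mul, mul_comm]
  rfl

/-! ### Linear control systems as operator equations -/

section ControlSystem

variable {E V : Type*} [NormedAddCommGroup E] [InnerProductSpace ℝ E]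

/-- `x ∈ L²` satisfies `P_i x(t) = u₀ i - ∫₀ᵗ D_i x` for almost every `t`, and
`u₁ i = u₀ i - ∫₀¹ D_i x`. -/
structure IsControlled (P D : V → E →L[ℝ] ℝ) (u₀ u₁ : V → ℝ) (x : ℝ → E) : Prop where
  memLp : MemLp x 2 unitVolume
  path : ∀ i, ∀ᵐ t ∂unitVolume, P i (x t) = u₀ i - ∫ s in (0 : ℝ)..t, D i (x s)
  final : ∀ i, u₁ i = u₀ i - ∫ s in (0 : ℝ)..1, D i (x s)

/-- The operator `x ↦ (P_i x + ∫₀ᵗ D_i x, ∫₀¹ D_i x)`. -/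
noncomputable def controlOperator (P D : V → E →L[ℝ] ℝ) :
    Lp E 2 unitVolume →L[ℝ] (V → Lp ℝ 2 unitVolume) × (V → ℝ) :=
  (ContinuousLinearMap.pi fun i => (P i).compLpL 2 unitVolume
      + volterra.comp ((D i).compLpL 2 unitVolume)).prod
    (ContinuousLinearMap.pi fun i => unitIntegral.comp ((D i).compLpL 2 unitVolume))

theorem controlOperator_fst (P D : V → E →L[ℝ] ℝ) (x : Lp E 2 unitVolume) (i : V) :
    (controlOperator P D x).1 i
      = (P i).compLp x + volterra ((D i).compLp x) := rfl

theorem controlOperator_snd (P D : V → E →L[ℝ] ℝ) (x : Lp E 2 unitVolume) (i : V) :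
    (controlOperator P D x).2 i = unitIntegral ((D i).compLp x) := rfl

theorem IsControlled.congr {P D : V → E →L[ℝ] ℝ} {u₀ u₁ : V → ℝ} {x y : ℝ → E}
    (h : IsControlled P D u₀ u₁ x) (hxy : x =ᵐ[unitVolume] y) : IsControlled P D u₀ u₁ y := by
  have hD : ∀ i, ∀ t ∈ Icc (0 : ℝ) 1,
      ∫ s in (0 : ℝ)..t, D i (x s) = ∫ s in (0 : ℝ)..t, D i (y s) := fun i t ht =>
    intervalIntegral_congr_unitVolume (hxy.fun_comp (D i)) ht
  refine ⟨h.memLp.ae_eq hxy, fun i => ?_, fun i => ?_⟩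
  · filter_upwards [h.path i, hxy, ae_restrict_mem measurableSet_Icc] with t h1 h2 ht
    rw [← h2, h1, hD i t ht]
  · rw [h.final i, hD i 1 (by simp)]

/-- An L² class has no value at time 1, so the terminal condition needs a coordinate of its own; the
initial condition is built into the integrated equation. -/
theorem controlOperator_eq_iff (P D : V → E →L[ℝ] ℝ) (u₀ u₁ : V → ℝ) (x : Lp E 2 unitVolume) :
    controlOperator P D x = (fun i => Lp.const 2 unitVolume (u₀ i), fun i => u₀ i - u₁ i)
      ↔ IsControlled P D u₀ u₁ x := by
  have hD : ∀ i, ∀ t ∈ Icc (0 : ℝ) 1,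
      ∫ s in (0 : ℝ)..t, (D i).compLp x s = ∫ s in (0 : ℝ)..t, D i (x s) := fun i t ht =>
    intervalIntegral_congr_unitVolume ((D i).coeFn_compLp' x) ht
  have hsnd : ∀ i, (controlOperator P D x).2 i = u₀ i - u₁ i
      ↔ u₁ i = u₀ i - ∫ s in (0 : ℝ)..1, D i (x s) := by
    intro i
    rw [controlOperator_snd, unitIntegral_apply, hD i 1 (by simp)]
    constructor <;> intro h <;> linarith
  have hfst : ∀ i, (controlOperator P D x).1 i = Lp.const 2 unitVolume (u₀ i)
      ↔ ∀ᵐ t ∂unitVolume, P i (x t) = u₀ i - ∫ s in (0 : ℝ)..t, D i (x s) := by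
    intro i
    rw [controlOperator_fst, Lp.ext_iff]
    have e : ∀ᵐ t ∂unitVolume, (((P i).compLp x + volterra ((D i).compLp x) : Lp ℝ 2 unitVolume) t
        = Lp.const 2 unitVolume (u₀ i) t
          ↔ P i (x t) = u₀ i - ∫ s in (0 : ℝ)..t, D i (x s)) := by
      filter_upwards [Lp.coeFn_add ((P i).compLp x) (volterra ((D i).compLp x)),
        (P i).coeFn_compLp x, coeFn_volterra ((D i).compLp x),
        Lp.coeFn_const (p := 2) (μ := unitVolume) (u₀ i),
        ae_restrict_mem measurableSet_Icc] with t h1 h2 h3 h4 ht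
      rw [h1, Pi.add_apply, h2, h3, h4, hD i t ht, Function.const_apply]
      constructor <;> intro h <;> linarith
    constructor
    · intro h
      filter_upwards [h, e] with t h1 h2 using h2.1 h1
    · intro h
      filter_upwards [h, e] with t h1 h2 using h2.2 h1
  constructor
  · intro h
    rw [Prod.ext_iff] at h
    exact ⟨Lp.memLp x, fun i => (hfst i).1 (congrFun h.1 i), fun i => (hsnd i).1 (congrFun h.2 i)⟩
  · intro h
    exact Prod.ext (funext fun i => (hfst i).2 (h.path i)) (funext fun i => (hsnd i).2 (h.final i))

end ControlSystem

/-! ### Minimization of coercive convex integrals under a control system -/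

section Control

variable {E : Type*} [NormedAddCommGroup E] [InnerProductSpace ℝ E] [MeasurableSpace E]

/-- The integrands to which the direct method applies: jointly measurable, lower semicontinuous,
convex and quadratically coercive. -/
structure IsCoerciveIntegrand (ℓ : ℝ → E → ℝ≥0∞) : Prop where
  measurable : Measurable (Function.uncurry ℓ)
  lsc : ∀ t, LowerSemicontinuous (ℓ t)
  convex : ∀ t x y, ∀ a b : ℝ≥0, a + b = 1 → ℓ t (a • x + b • y) ≤ a * ℓ t x + b * ℓ t y
  coercive : ∃ K : ℝ≥0, ∀ t ∈ Icc (0 : ℝ) 1, ∀ x, ‖x‖ₑ ^ (2 : ℝ) ≤ K * (ℓ t x + 1)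

namespace IsCoerciveIntegrand

variable {ℓ : ℝ → E → ℝ≥0∞}

theorem aemeasurable [BorelSpace E] (h : IsCoerciveIntegrand ℓ) {x : ℝ → E}
    (hx : AEStronglyMeasurable x unitVolume) : AEMeasurable (fun t => ℓ t (x t)) unitVolume :=
  h.measurable.comp_aemeasurable (aemeasurable_id.prodMk hx.aemeasurable)

theorem lintegral_convex [BorelSpace E] (h : IsCoerciveIntegrand ℓ) (x y : Lp E 2 unitVolume) (a b : ℝ≥0)
    (hab : a + b = 1) :
    ∫⁻ t, ℓ t ((a • x + b • y : Lp E 2 unitVolume) t) ∂unitVolume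
      ≤ a * ∫⁻ t, ℓ t (x t) ∂unitVolume + b * ∫⁻ t, ℓ t (y t) ∂unitVolume := by
  rw [← lintegral_const_mul'' _ (h.aemeasurable (Lp.aestronglyMeasurable x)),
    ← lintegral_const_mul'' _ (h.aemeasurable (Lp.aestronglyMeasurable y)),
    ← lintegral_add_left' ((h.aemeasurable (Lp.aestronglyMeasurable x)).const_mul _)]
  refine lintegral_mono_ae ?_
  filter_upwards [Lp.coeFn_add (a • x) (b • y), Lp.coeFn_smul (a : ℝ) x, Lp.coeFn_smul (b : ℝ) y]
    with t h1 h2 h3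
  have h2' : (a • x : Lp E 2 unitVolume) t = a • x t := h2
  have h3' : (b • y : Lp E 2 unitVolume) t = b • y t := h3
  rw [h1, Pi.add_apply, h2', h3']
  exact h.convex t _ _ a b hab

/-- An L² limit is an almost everywhere limit along a subsequence, and Fatou's lemma applies. Strong
closedness is enough, since convexity is exploited separately. -/
theorem isClosed_sublevel [BorelSpace E] (h : IsCoerciveIntegrand ℓ) (r : ℝ≥0) :
    IsClosed {x : Lp E 2 unitVolume | ∫⁻ t, ℓ t (x t) ∂unitVolume ≤ r} := by
  refine IsSeqClosed.isClosed fun x x₀ hx hlim => ?_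
  obtain ⟨φ, -, hφ⟩ := (tendstoInMeasure_of_tendsto_Lp hlim).exists_seq_tendsto_ae
  calc ∫⁻ t, ℓ t (x₀ t) ∂unitVolume
      ≤ ∫⁻ t, Filter.liminf (fun n => ℓ t (x (φ n) t)) Filter.atTop ∂unitVolume := by
        refine lintegral_mono_ae ?_
        filter_upwards [hφ] with t ht
        refine ((h.lsc t).le_liminf (x₀ t)).trans ?_
        exact Filter.liminf_le_liminf_of_le ht
    _ ≤ Filter.liminf (fun n => ∫⁻ t, ℓ t (x (φ n) t) ∂unitVolume) Filter.atTop :=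
        lintegral_liminf_le' fun n => h.aemeasurable (Lp.aestronglyMeasurable _)
    _ ≤ r := by
        refine (Filter.liminf_le_liminf (v := fun _ => (r : ℝ≥0∞))
          (Filter.Eventually.of_forall fun n => hx (φ n))).trans ?_
        rw [Filter.liminf_const]

theorem isBounded_sublevel (h : IsCoerciveIntegrand ℓ) (r : ℝ≥0) :
    Bornology.IsBounded {x : Lp E 2 unitVolume | ∫⁻ t, ℓ t (x t) ∂unitVolume ≤ r} := by
  obtain ⟨K, hK⟩ := h.coercive
  refine isBounded_iff_forall_norm_le.2 ⟨((K * (r + 1) : ℝ≥0) ^ ((1 : ℝ) / 2) : ℝ≥0), ?_⟩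
  intro x hx
  have h1 : ∫⁻ t, ‖x t‖ₑ ^ (2 : ℝ) ∂unitVolume ≤ (K * (r + 1) : ℝ≥0) := by
    calc ∫⁻ t, ‖x t‖ₑ ^ (2 : ℝ) ∂unitVolume
        ≤ ∫⁻ t, K * (ℓ t (x t) + 1) ∂unitVolume := by
          refine lintegral_mono_ae ?_
          filter_upwards [ae_restrict_mem measurableSet_Icc] with t ht using hK t ht _
      _ = K * (∫⁻ t, ℓ t (x t) ∂unitVolume + 1) := by
          rw [lintegral_const_mul' _ _ ENNReal.coe_ne_top,
            lintegral_add_right _ measurable_const, lintegral_const, measure_univ, one_mul]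
      _ ≤ (K * (r + 1) : ℝ≥0) := by
          push_cast
          gcongr
          exact hx
  rw [Lp.norm_def, eLpNorm_eq_lintegral_rpow_enorm_toReal two_ne_zero ENNReal.ofNat_ne_top]
  refine ENNReal.toReal_le_of_le_ofReal (NNReal.coe_nonneg _) ?_
  rw [ENNReal.ofReal_coe_nnreal, ENNReal.coe_rpow_of_nonneg _ (by norm_num)]
  rw [ENNReal.toReal_ofNat]
  exact ENNReal.rpow_le_rpow h1 (by norm_num)

end IsCoerciveIntegrand

variable {V : Type*} [Fintype V]

/-- Duality for the minimization of a coercive convex integral under a linear control system. -/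
theorem exists_min_control_and_dual [BorelSpace E] [CompleteSpace E] {ℓ : ℝ → E → ℝ≥0∞}
    (hℓ : IsCoerciveIntegrand ℓ)
    (P D : V → E →L[ℝ] ℝ) (u₀ u₁ : V → ℝ)
    (hne : ∃ x, IsControlled P D u₀ u₁ x ∧ ∫⁻ t, ℓ t (x t) ∂unitVolume ≠ ⊤) :
    ∃ a : ℝ≥0, (∃ x, IsControlled P D u₀ u₁ x ∧ ∫⁻ t, ℓ t (x t) ∂unitVolume = a) ∧
      ∀ ε > 0, ∃ S S' : V → ℝ → ℝ,
        (∀ i, IsPrimitive (S i) (S' i) ∧ Continuous (S i) ∧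
          MemLp (S' i) 2 unitVolume ∧ Measurable (S' i)) ∧
        ∀ x : ℝ → E, MemLp x 2 unitVolume → ∫⁻ t, ℓ t (x t) ∂unitVolume ≠ ⊤ →
          (a : ℝ) - ε ≤ ∑ i, (S i 1 * u₁ i - S i 0 * u₀ i)
            + ∫ t, ∑ i, (S i t * D i (x t) - S' i t * P i (x t)) ∂unitVolume
            + (∫⁻ t, ℓ t (x t) ∂unitVolume).toReal := by
  obtain ⟨x₀, hx₀, hx₀A⟩ := hne
  have hx₀' := hx₀.memLp.coeFn_toLp
  obtain ⟨a, ⟨x, hx, hxA⟩, hdual⟩ := exists_min_and_dual_functional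
    (A := fun x : Lp E 2 unitVolume => ∫⁻ t, ℓ t (x t) ∂unitVolume)
    hℓ.lintegral_convex hℓ.isClosed_sublevel hℓ.isBounded_sublevel (controlOperator P D)
    (y₀ := (fun i => Lp.const 2 unitVolume (u₀ i), fun i => u₀ i - u₁ i))
    ⟨hx₀.memLp.toLp, (controlOperator_eq_iff P D u₀ u₁ _).2 (hx₀.congr hx₀'.symm), by
      rwa [lintegral_integrand_congr hx₀']⟩
  refine ⟨a, ⟨x, (controlOperator_eq_iff P D u₀ u₁ _).1 hx, hxA⟩, fun ε hε => ?_⟩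
  obtain ⟨f, hf⟩ := hdual ε hε
  obtain ⟨z, c, hzc⟩ := exists_riesz_representation f
  have hz : ∀ i, Integrable (z i) unitVolume := fun i => integrable_of_memLp (Lp.memLp (z i))
  -- The potential is S_i(t) = c_i + ∫ₜ¹ z_i: the tail integral is the adjoint Volterra operator
  -- applied to z_i, and the constant is the multiplier of the terminal condition.
  have hS : ∀ i, IsPrimitive (fun t => c i + ((∫ s in (0 : ℝ)..1, z i s) - ∫ s in (0 : ℝ)..t, z i s))
      (fun t => - z i t) := by
    intro i
    refine ⟨(hz i).neg, fun t _ => ?_⟩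
    rw [intervalIntegral.integral_neg, intervalIntegral.integral_same]
    ring
  refine ⟨fun i t => c i + ((∫ s in (0 : ℝ)..1, z i s)
      - ∫ s in (0 : ℝ)..(projIcc (0 : ℝ) 1 zero_le_one t), z i s),
    fun i t => - z i t, fun i => ⟨(hS i).comp_projIcc, (hS i).continuous_comp_projIcc,
      (Lp.memLp (z i)).neg, (Lp.stronglyMeasurable (z i)).measurable.neg⟩, fun w hw hwA => ?_⟩
  have hw' := hw.coeFn_toLp
  have h := hf hw.toLp (by rwa [lintegral_integrand_congr hw'])
  rw [lintegral_integrand_congr hw'] at h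
  refine h.trans_eq ?_
  congr 1
  have hsub : controlOperator P D hw.toLp
      - (fun i => Lp.const 2 unitVolume (u₀ i), fun i => u₀ i - u₁ i)
      = (fun i => (P i).compLp hw.toLp + volterra ((D i).compLp hw.toLp)
          - Lp.const 2 unitVolume (u₀ i),
        fun i => unitIntegral ((D i).compLp hw.toLp) - (u₀ i - u₁ i)) := rfl
  rw [hsub, hzc, ← Finset.sum_add_distrib]
  have hPw : ∀ i, (P i).compLp hw.toLp =ᵐ[unitVolume] fun t => P i (w t) := fun i =>
    ((P i).coeFn_compLp' _).trans (hw'.fun_comp (P i))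
  have hDw : ∀ i, (D i).compLp hw.toLp =ᵐ[unitVolume] fun t => D i (w t) := fun i =>
    ((D i).coeFn_compLp' _).trans (hw'.fun_comp (D i))
  have hDint : ∀ i, Integrable (fun t => D i (w t)) unitVolume := fun i =>
    integrable_of_memLp ((D i).comp_memLp' hw)
  have hPint : ∀ i, Integrable (fun t => - z i t * P i (w t)) unitVolume := fun i =>
    (Lp.memLp (z i)).neg.integrable_mul ((P i).comp_memLp' hw)
  have hSD := fun i => (hS i).integrable_mul (hDint i)
  have hsum := integral_finsetSum (μ := unitVolume) Finset.univ
    (f := fun i t => (c i + ((∫ s in (0 : ℝ)..1, z i s) - ∫ s in (0 : ℝ)..t, z i s)) * D i (w t)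
      - - z i t * P i (w t)) fun i _ => (hSD i).sub (hPint i)
  have hproj : ∫ t, ∑ i, ((c i + ((∫ s in (0 : ℝ)..1, z i s)
        - ∫ s in (0 : ℝ)..(projIcc (0 : ℝ) 1 zero_le_one t), z i s)) * D i (w t)
          - - z i t * P i (w t)) ∂unitVolume
      = ∫ t, ∑ i, ((c i + ((∫ s in (0 : ℝ)..1, z i s) - ∫ s in (0 : ℝ)..t, z i s)) * D i (w t)
          - - z i t * P i (w t)) ∂unitVolume := by
    refine integral_congr_ae ?_
    filter_upwards [ae_restrict_mem measurableSet_Icc] with t ht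
    rw [projIcc_of_mem zero_le_one ht]
  beta_reduce at hsum ⊢
  rw [hproj, hsum, ← Finset.sum_add_distrib]
  refine Finset.sum_congr rfl fun i _ => ?_
  rw [integral_sub (hSD i) (hPint i), inner_sub_right, inner_add_right, inner_volterra]
  have e1 : inner ℝ (z i) ((P i).compLp hw.toLp) = - ∫ t, - z i t * P i (w t) ∂unitVolume := by
    rw [L2.inner_def, ← integral_neg]
    refine integral_congr_ae ?_
    filter_upwards [hPw i] with t ht
    rw [ht]
    simp [mul_comm]
  have e2 : inner ℝ (z i) (Lp.const 2 unitVolume (u₀ i)) = (∫ s in (0 : ℝ)..1, z i s) * u₀ i := by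
    rw [L2.inner_def, ← integral_unitVolume, ← integral_mul_const]
    refine integral_congr_ae ?_
    filter_upwards [Lp.coeFn_const (p := 2) (μ := unitVolume) (u₀ i)] with t ht
    rw [ht]
    simp [mul_comm]
  have e3 : ∫ t, ((∫ s in (0 : ℝ)..1, z i s) - ∫ s in (0 : ℝ)..t, z i s)
        * (D i).compLp hw.toLp t ∂unitVolume
      = ∫ t, ((∫ s in (0 : ℝ)..1, z i s) - ∫ s in (0 : ℝ)..t, z i s) * D i (w t) ∂unitVolume := by
    refine integral_congr_ae ?_
    filter_upwards [hDw i] with t ht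
    rw [ht]
  have e4 : unitIntegral ((D i).compLp hw.toLp) = ∫ t, D i (w t) ∂unitVolume := by
    rw [unitIntegral_apply, ← integral_unitVolume]
    exact integral_congr_ae (hDw i)
  have e5 : ∫ t, (c i + ((∫ s in (0 : ℝ)..1, z i s) - ∫ s in (0 : ℝ)..t, z i s))
        * D i (w t) ∂unitVolume
      = c i * ∫ t, D i (w t) ∂unitVolume
        + ∫ t, ((∫ s in (0 : ℝ)..1, z i s) - ∫ s in (0 : ℝ)..t, z i s) * D i (w t) ∂unitVolume := by
    rw [← integral_const_mul, ← integral_add ((hDint i).const_mul _)]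
    · refine integral_congr_ae (ae_of_all _ fun t => ?_)
      simp only
      ring
    · refine ((hSD i).sub ((hDint i).const_mul (c i))).congr (ae_of_all _ fun t => ?_)
      simp only [Pi.sub_apply]
      ring
  rw [e1, e2, e3, e4, e5]
  simp only [intervalIntegral.integral_same, projIcc_left, projIcc_right]
  ring

end Control

/-! ### The edge cost as a supremum of affine functions -/

section EdgeCost

theorem ofReal_le_edgeCost (x y b : ℝ) :
    ENNReal.ofReal (2 * b * y - b ^ 2 * x) ≤ edgeCost x y := by
  unfold edgeCost
  split_ifs with hx h0
  · refine ENNReal.ofReal_le_ofReal ?_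
    rw [le_div_iff₀ hx]
    nlinarith [sq_nonneg (y - b * x)]
  · simp [h0.1, h0.2]
  · exact le_top

/-- For `x ≥ 0`, `edgeCost x y` is the supremum of its affine minorants `2by - b²x`. -/
theorem edgeCost_eq_iSup {x : ℝ} (hx : 0 ≤ x) (y : ℝ) :
    edgeCost x y = ⨆ b : ℝ, ENNReal.ofReal (2 * b * y - b ^ 2 * x) := by
  refine le_antisymm ?_ (iSup_le fun b => ofReal_le_edgeCost x y b)
  rcases hx.lt_or_eq with hx | rfl
  · refine le_trans ?_ (le_iSup _ (y / x))
    rw [edgeCost, if_pos hx]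
    refine ENNReal.ofReal_le_ofReal (le_of_eq ?_)
    field_simp
    ring
  · by_cases hy : y = 0
    · simp [edgeCost, hy]
    · have htop : ⨆ b : ℝ, ENNReal.ofReal (2 * b * y - b ^ 2 * 0) = ⊤ := by
        refine ENNReal.eq_top_of_forall_nnreal_le fun r => ?_
        refine le_trans (le_of_eq ?_) (le_iSup _ ((r : ℝ) / (2 * y)))
        rw [← ENNReal.ofReal_coe_nnreal]
        congr 1
        field_simp
        ring
      rw [htop]
      exact le_top

theorem lowerSemicontinuous_edgeCost {X : Type*} [TopologicalSpace X] {f g : X → ℝ}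
    (hf : Continuous f) (hg : Continuous g) (hf0 : ∀ x, 0 ≤ f x) :
    LowerSemicontinuous fun x => edgeCost (f x) (g x) := by
  have : (fun x => edgeCost (f x) (g x))
      = fun x => ⨆ b : ℝ, ENNReal.ofReal (2 * b * g x - b ^ 2 * f x) :=
    funext fun x => edgeCost_eq_iSup (hf0 x) _
  rw [this]
  refine lowerSemicontinuous_iSup fun b => Continuous.lowerSemicontinuous ?_
  exact ENNReal.continuous_ofReal.comp (by fun_prop)

/-- Each minorant 2by - b²x is homogeneous in (x, y) and nonincreasing in x. Hence an inequality on
the weights suffices, which is what concavity of Θ provides. -/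
theorem edgeCost_convex {x₁ x₂ x y₁ y₂ : ℝ} (hx : 0 ≤ x) (a b : ℝ≥0)
    (h : a * x₁ + b * x₂ ≤ x) :
    edgeCost x (a * y₁ + b * y₂) ≤ a * edgeCost x₁ y₁ + b * edgeCost x₂ y₂ := by
  rw [edgeCost_eq_iSup hx]
  refine iSup_le fun k => ?_
  calc ENNReal.ofReal (2 * k * (a * y₁ + b * y₂) - k ^ 2 * x)
      ≤ ENNReal.ofReal (a * (2 * k * y₁ - k ^ 2 * x₁) + b * (2 * k * y₂ - k ^ 2 * x₂)) := by
        refine ENNReal.ofReal_le_ofReal ?_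
        nlinarith [sq_nonneg k]
    _ ≤ ENNReal.ofReal (a * (2 * k * y₁ - k ^ 2 * x₁))
        + ENNReal.ofReal (b * (2 * k * y₂ - k ^ 2 * x₂)) := ENNReal.ofReal_add_le
    _ = a * ENNReal.ofReal (2 * k * y₁ - k ^ 2 * x₁)
        + b * ENNReal.ofReal (2 * k * y₂ - k ^ 2 * x₂) := by
        rw [ENNReal.ofReal_mul a.coe_nonneg, ENNReal.ofReal_mul b.coe_nonneg,
          ENNReal.ofReal_coe_nnreal, ENNReal.ofReal_coe_nnreal]
    _ ≤ a * edgeCost x₁ y₁ + b * edgeCost x₂ y₂ := by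
        gcongr <;> exact ofReal_le_edgeCost _ _ _

/-- The minorant with slope b = y already gives this. Since weights on the simplex are at most 1, it
is the source of L² coercivity in the flux. -/
theorem ofReal_sq_le_edgeCost {x : ℝ} (hx : x ≤ 1) (y : ℝ) :
    ENNReal.ofReal (y ^ 2) ≤ edgeCost x y := by
  refine le_trans (ENNReal.ofReal_le_ofReal ?_) (ofReal_le_edgeCost x y y)
  nlinarith [sq_nonneg y]

theorem edgeCost_mul_self {x : ℝ} (hx : 0 ≤ x) (k : ℝ) :
    edgeCost x (k * x) = ENNReal.ofReal (k ^ 2 * x) := by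
  rcases hx.lt_or_eq with hx | rfl
  · rw [edgeCost, if_pos hx]
    congr 1
    field_simp
  · simp [edgeCost]

theorem edgeCost_mul {k : ℝ} (hk : k ≠ 0) (x y : ℝ) :
    edgeCost x (k * y) = ENNReal.ofReal (k ^ 2) * edgeCost x y := by
  unfold edgeCost
  have hk2 : 0 < k ^ 2 := by positivity
  by_cases hx : 0 < x
  · rw [if_pos hx, if_pos hx, ← ENNReal.ofReal_mul hk2.le]
    congr 1
    ring
  · rw [if_neg hx, if_neg hx]
    by_cases h : x = 0 ∧ y = 0
    · simp [h.1, h.2]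
    · have h' : ¬(x = 0 ∧ k * y = 0) := by simpa [hk] using h
      rw [if_neg h, if_neg h', ENNReal.mul_top]
      simpa using hk

/-- Every minorant satisfies 2bsq - b²x ≤ 2bsq - b²s²κ ≤ q²/κ by completing the square. A flux
vanishing to first order is thus affordable where the density vanishes to second order, the
degenerate case s = 0 included. -/
theorem edgeCost_le_of_sq_mul_le {x s κ : ℝ} (hκ : 0 < κ) (hx : s ^ 2 * κ ≤ x) (q : ℝ) :
    edgeCost x (s * q) ≤ ENNReal.ofReal (q ^ 2 / κ) := by
  have h0 : 0 ≤ x := le_trans (by positivity) hx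
  rw [edgeCost_eq_iSup h0]
  refine iSup_le fun b => ENNReal.ofReal_le_ofReal ?_
  rw [le_div_iff₀ hκ]
  have h1 : b ^ 2 * (s ^ 2 * κ) ≤ b ^ 2 * x := by gcongr
  nlinarith [sq_nonneg (q - b * s * κ)]

end EdgeCost

/-! ### Properties of the edge weight -/

namespace IsProbWeight

variable {Θ : ℝ → ℝ → ℝ}

theorem nonneg (h : IsProbWeight Θ) {s t : ℝ} (hs : 0 ≤ s) (ht : 0 ≤ t) : 0 ≤ Θ s t :=
  (le_min hs ht).trans (h.min_le s t hs ht)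

theorem le_one (h : IsProbWeight Θ) {s t : ℝ} (hs : 0 ≤ s) (ht : 0 ≤ t) (hs1 : s ≤ 1)
    (ht1 : t ≤ 1) : Θ s t ≤ 1 :=
  (h.le_max s t hs ht).trans (max_le hs1 ht1)

/-- Shift all coordinates by e > 0 into the open quadrant, use concavity there, and let e tend to 0
by continuity up to the boundary. -/
theorem concave_closed (h : IsProbWeight Θ) {s₁ t₁ s₂ t₂ a b : ℝ} (hs₁ : 0 ≤ s₁) (ht₁ : 0 ≤ t₁)
    (hs₂ : 0 ≤ s₂) (ht₂ : 0 ≤ t₂) (ha : 0 ≤ a) (hb : 0 ≤ b) (hab : a + b = 1) :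
    a * Θ s₁ t₁ + b * Θ s₂ t₂ ≤ Θ (a * s₁ + b * s₂) (a * t₁ + b * t₂) := by
  have key : ∀ {s t : ℝ}, 0 ≤ s → 0 ≤ t →
      Filter.Tendsto (fun e : ℝ => Θ (s + e) (t + e)) (nhdsWithin 0 (Ioi 0)) (nhds (Θ s t)) := by
    intro s t hs ht
    have h1 : ContinuousWithinAt (fun p : ℝ × ℝ => Θ p.1 p.2) (Ici 0 ×ˢ Ici 0) (s, t) :=
      h.cont (s, t) ⟨hs, ht⟩
    have h2 : Filter.Tendsto (fun e : ℝ => (s + e, t + e)) (nhdsWithin 0 (Ioi 0))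
        (nhdsWithin (s, t) (Ici 0 ×ˢ Ici 0)) := by
      refine tendsto_nhdsWithin_iff.2 ⟨?_, ?_⟩
      · have : Continuous fun e : ℝ => (s + e, t + e) := by fun_prop
        have := this.tendsto 0
        simp only [add_zero] at this
        exact this.mono_left nhdsWithin_le_nhds
      · filter_upwards [self_mem_nhdsWithin] with e he
        have he : 0 < e := he
        exact ⟨by simp only [mem_Ici]; linarith, by simp only [mem_Ici]; linarith⟩
    exact h1.tendsto.comp h2
  have hl := ((key hs₁ ht₁).const_mul a).add ((key hs₂ ht₂).const_mul b)
  have hr := key (s := a * s₁ + b * s₂) (t := a * t₁ + b * t₂) (by positivity) (by positivity)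
  refine le_of_tendsto_of_tendsto hl hr ?_
  filter_upwards [self_mem_nhdsWithin] with e he
  have he : 0 < e := he
  have hc := h.concave.2 (x := (s₁ + e, t₁ + e)) (y := (s₂ + e, t₂ + e))
    ⟨by simp only [mem_Ioi]; linarith, by simp only [mem_Ioi]; linarith⟩
    ⟨by simp only [mem_Ioi]; linarith, by simp only [mem_Ioi]; linarith⟩ ha hb hab
  simp only [Prod.smul_mk, smul_eq_mul, Prod.mk_add_mk] at hc
  have e1 : ∀ u v : ℝ, a * (u + e) + b * (v + e) = a * u + b * v + e := by
    intro u v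
    linear_combination e * hab
  rwa [e1, e1] at hc

/-- Clamping at zero makes the weight continuous on the whole space, so lower semicontinuity and
measurability of the energy need no restriction to the simplex. -/
theorem continuous_posPart (h : IsProbWeight Θ) {X : Type*} [TopologicalSpace X] {f g : X → ℝ}
    (hf : Continuous f) (hg : Continuous g) :
    Continuous fun x => Θ (max (f x) 0) (max (g x) 0) := by
  have h1 : Continuous fun x => ((max (f x) 0, max (g x) 0) : ℝ × ℝ) := by fun_prop
  exact h.cont.comp_continuous h1 fun x =>
    ⟨le_max_right (f x) 0, le_max_right (g x) 0⟩

end IsProbWeight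

/-! ### The energy as a coercive integrand on densities and fluxes -/

section Integrand

variable {V : Type*} [Fintype V] (G : SimpleGraph V) [DecidableRel G.Adj]

/-- The space of pairs of a density and a flux. -/
abbrev FlowSpace (V : Type*) : Type _ := EuclideanSpace ℝ (V ⊕ V × V)

/-- The density coordinates. -/
noncomputable def densityCoord (i : V) : FlowSpace V →L[ℝ] ℝ := EuclideanSpace.proj (Sum.inl i)

/-- The flux coordinates. -/
noncomputable def fluxCoord (i j : V) : FlowSpace V →L[ℝ] ℝ :=
  EuclideanSpace.proj (Sum.inr (i, j))

/-- The divergence of the flux. -/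
noncomputable def fluxDiv (i : V) : FlowSpace V →L[ℝ] ℝ := ∑ j ∈ G.neighborFinset i, fluxCoord i j

theorem fluxDiv_apply (i : V) (x : FlowSpace V) :
    fluxDiv G i x = ∑ j ∈ G.neighborFinset i, fluxCoord i j x := by
  simp [fluxDiv, sum_apply]

/-- Densities in the simplex with skew-symmetric fluxes supported on the edges. -/
def flowSet : Set (FlowSpace V) :=
  {x | (fun i => densityCoord i x) ∈ stdSimplex ℝ V ∧
    (∀ i j, fluxCoord i j x = - fluxCoord j i x) ∧ ∀ i j, ¬ G.Adj i j → fluxCoord i j x = 0}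

omit [DecidableRel G.Adj] in
theorem isClosed_flowSet : IsClosed (flowSet G) := by
  have h : flowSet G = (fun x i => densityCoord i x) ⁻¹' stdSimplex ℝ V ∩
      ((⋂ i, ⋂ j, {x | fluxCoord i j x = - fluxCoord j i x}) ∩
        ⋂ i, ⋂ j, ⋂ _ : ¬ G.Adj i j, {x | fluxCoord i j x = 0}) := by
    ext x
    simp [flowSet]
  rw [h]
  refine IsClosed.inter ?_ (IsClosed.inter ?_ ?_)
  · exact (isClosed_stdSimplex ℝ V).preimage (by fun_prop)
  · exact isClosed_iInter fun i => isClosed_iInter fun j =>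
      isClosed_eq (by fun_prop) (by fun_prop)
  · exact isClosed_iInter fun i => isClosed_iInter fun j => isClosed_iInter fun _ =>
      isClosed_eq (by fun_prop) (by fun_prop)

omit [DecidableRel G.Adj] in
theorem convex_flowSet : Convex ℝ (flowSet G) := by
  rintro x ⟨hx1, hx2, hx3⟩ y ⟨hy1, hy2, hy3⟩ a b ha hb hab
  refine ⟨?_, fun i j => ?_, fun i j hij => ?_⟩
  · convert convex_stdSimplex ℝ V hx1 hy1 ha hb hab using 1
    ext i
    simp
  · rw [map_add, map_smul, map_smul, map_add, map_smul, map_smul, hx2 i j, hy2 i j]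
    simp only [smul_eq_mul]
    ring
  · rw [map_add, map_smul, map_smul, hx3 i j hij, hy3 i j hij]
    simp

/-- The kinetic energy of a density and a flux. -/
noncomputable def flowCost (Θ : ℝ → ℝ → ℝ) (x : FlowSpace V) : ℝ≥0∞ :=
  (1 / 4) * ∑ i, ∑ j ∈ G.neighborFinset i,
    edgeCost (Θ (max (densityCoord i x) 0) (max (densityCoord j x) 0)) (fluxCoord i j x)

/-- The kinetic energy with weight `c⁻²`, infinite outside `flowSet`. -/
noncomputable def flowIntegrand (Θ : ℝ → ℝ → ℝ) (c : ℝ → ℝ) (t : ℝ) (x : FlowSpace V) : ℝ≥0∞ :=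
  ENNReal.ofReal (1 / c t ^ 2) * (flowCost G Θ x + (flowSet G)ᶜ.indicator (fun _ => ⊤) x)

theorem flowCost_of_mem (Θ : ℝ → ℝ → ℝ) {x : FlowSpace V} (hx : x ∈ flowSet G) :
    flowCost G Θ x = (1 / 4) * ∑ i, ∑ j ∈ G.neighborFinset i,
      edgeCost (Θ (densityCoord i x) (densityCoord j x)) (fluxCoord i j x) := by
  simp only [flowCost, max_eq_left (hx.1.1 _)]

theorem flowIntegrand_of_mem (Θ : ℝ → ℝ → ℝ) (c : ℝ → ℝ) (t : ℝ) {x : FlowSpace V}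
    (hx : x ∈ flowSet G) :
    flowIntegrand G Θ c t x = ENNReal.ofReal (1 / c t ^ 2) * flowCost G Θ x := by
  rw [flowIntegrand, indicator_of_notMem (by simpa using hx), add_zero]

theorem flowIntegrand_of_notMem (Θ : ℝ → ℝ → ℝ) {c : ℝ → ℝ} {t : ℝ} (ht : c t ≠ 0)
    {x : FlowSpace V} (hx : x ∉ flowSet G) : flowIntegrand G Θ c t x = ⊤ := by
  rw [flowIntegrand, indicator_of_mem (by simpa using hx), add_top, ENNReal.mul_top]
  have : 0 < c t ^ 2 := by positivity
  simpa using ht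

theorem mem_flowSet_of_flowIntegrand_ne_top (Θ : ℝ → ℝ → ℝ) {c : ℝ → ℝ} {t : ℝ} (ht : c t ≠ 0)
    {x : FlowSpace V} (hx : flowIntegrand G Θ c t x ≠ ⊤) : x ∈ flowSet G := by
  by_contra h
  exact hx (flowIntegrand_of_notMem G Θ ht h)

theorem lowerSemicontinuous_flow {Θ : ℝ → ℝ → ℝ} (hΘ : IsProbWeight Θ) :
    LowerSemicontinuous fun x => flowCost G Θ x + (flowSet G)ᶜ.indicator (fun _ => ⊤) x := by
  refine LowerSemicontinuous.add ?_
    ((isClosed_flowSet G).isOpen_compl.lowerSemicontinuous_indicator bot_le)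
  refine (ENNReal.continuous_const_mul (by simp)).comp_lowerSemicontinuous (?_) ?_
  · refine lowerSemicontinuous_sum fun i _ => lowerSemicontinuous_sum fun j _ => ?_
    exact lowerSemicontinuous_edgeCost
      (hΘ.continuous_posPart (by fun_prop) (by fun_prop)) (by fun_prop)
      fun x => hΘ.nonneg (le_max_right _ _) (le_max_right _ _)
  · exact fun x y hxy => by simp only; gcongr

theorem flowCost_convex {Θ : ℝ → ℝ → ℝ} (hΘ : IsProbWeight Θ) {x y : FlowSpace V}
    (hx : x ∈ flowSet G) (hy : y ∈ flowSet G) (a b : ℝ≥0) (hab : a + b = 1) :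
    flowCost G Θ (a • x + b • y) ≤ a * flowCost G Θ x + b * flowCost G Θ y := by
  have hab' : (a : ℝ) + b = 1 := by exact_mod_cast hab
  have hxy : a • x + b • y ∈ flowSet G :=
    convex_flowSet G hx hy a.coe_nonneg b.coe_nonneg hab'
  rw [flowCost_of_mem G Θ hxy, flowCost_of_mem G Θ hx, flowCost_of_mem G Θ hy,
    mul_left_comm, mul_left_comm (b : ℝ≥0∞), ← mul_add]
  gcongr
  simp only [Finset.mul_sum, ← Finset.sum_add_distrib]
  refine Finset.sum_le_sum fun i _ => Finset.sum_le_sum fun j _ => ?_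
  have hcoord : ∀ k : FlowSpace V →L[ℝ] ℝ, k (a • x + b • y) = a * k x + b * k y := by
    intro k
    rw [map_add, NNReal.smul_def, NNReal.smul_def, map_smul, map_smul, smul_eq_mul, smul_eq_mul]
  rw [hcoord (fluxCoord i j)]
  refine edgeCost_convex (hΘ.nonneg (hxy.1.1 i) (hxy.1.1 j)) a b ?_
  beta_reduce
  rw [hcoord, hcoord]
  exact hΘ.concave_closed (hx.1.1 i) (hx.1.1 j) (hy.1.1 i) (hy.1.1 j) a.coe_nonneg b.coe_nonneg
    hab'

theorem le_one_of_mem_stdSimplex {r : V → ℝ} (hr : r ∈ stdSimplex ℝ V) (i : V) : r i ≤ 1 := by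
  rw [← hr.2]
  exact Finset.single_le_sum (fun j _ => hr.1 j) (Finset.mem_univ i)

theorem sum_sq_fluxCoord_le {Θ : ℝ → ℝ → ℝ} (hΘ : IsProbWeight Θ) {x : FlowSpace V}
    (hx : x ∈ flowSet G) :
    ENNReal.ofReal (∑ i, ∑ j, fluxCoord i j x ^ 2) ≤ 4 * flowCost G Θ x := by
  have h4 : (4 : ℝ≥0∞) * (1 / 4) = 1 := by
    rw [one_div]
    exact ENNReal.mul_inv_cancel (by simp) (by simp)
  rw [flowCost_of_mem G Θ hx, ← mul_assoc, h4, one_mul,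
    ENNReal.ofReal_sum_of_nonneg fun i _ => Finset.sum_nonneg fun j _ => sq_nonneg _]
  refine Finset.sum_le_sum fun i _ => ?_
  rw [← Finset.sum_subset (Finset.subset_univ (G.neighborFinset i)),
    ENNReal.ofReal_sum_of_nonneg fun j _ => sq_nonneg _]
  · refine Finset.sum_le_sum fun j _ => ofReal_sq_le_edgeCost ?_ _
    exact hΘ.le_one (hx.1.1 i) (hx.1.1 j) (le_one_of_mem_stdSimplex hx.1 i)
      (le_one_of_mem_stdSimplex hx.1 j)
  · intro j _ hj
    rw [hx.2.2 i j (by simpa using hj)]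
    simp

theorem norm_sq_flowSpace (x : FlowSpace V) :
    ‖x‖ ^ 2 = ∑ i, densityCoord i x ^ 2 + ∑ i, ∑ j, fluxCoord i j x ^ 2 := by
  rw [EuclideanSpace.norm_sq_eq, Fintype.sum_sum_type, Fintype.sum_prod_type]
  simp only [Real.norm_eq_abs, sq_abs]
  rfl

theorem isCoerciveIntegrand_flowIntegrand {Θ : ℝ → ℝ → ℝ} (hΘ : IsProbWeight Θ) {c : ℝ → ℝ}
    (hc : Measurable c) {K : ℝ} (hc0 : ∀ t ∈ Icc (0 : ℝ) 1, c t ≠ 0)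
    (hcK : ∀ t ∈ Icc (0 : ℝ) 1, |c t| ≤ K) :
    IsCoerciveIntegrand (flowIntegrand G Θ c) where
  measurable := by
    have h1 := (lowerSemicontinuous_flow G hΘ).measurable
    have h2 : Measurable fun t => ENNReal.ofReal (1 / c t ^ 2) := by fun_prop
    exact (h2.comp measurable_fst).mul (h1.comp measurable_snd)
  lsc t := (ENNReal.continuous_const_mul ENNReal.ofReal_ne_top).comp_lowerSemicontinuous
    (lowerSemicontinuous_flow G hΘ) fun x y hxy => by simp only; gcongr
  convex t x y a b hab := by
    -- Where c t = 0 the convention 1/0 = 0 makes the integrand vanish identically, so this case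
    -- must be split off: membership in `flowSet` is then not enforced.
    by_cases hw : ENNReal.ofReal (1 / c t ^ 2) = 0
    · simp only [flowIntegrand, hw, zero_mul, zero_le]
    -- The cases a = 0 and b = 0 are separate because 0 * ⊤ = 0, while the argument below needs an
    -- infinite value to stay infinite after scaling.
    rcases eq_or_ne a 0 with rfl | ha
    · have hb : b = 1 := by simpa using hab
      simp [hb]
    rcases eq_or_ne b 0 with rfl | hb
    · have ha : a = 1 := by simpa using hab
      simp [ha]
    have ht : c t ≠ 0 := by
      intro h
      simp [h] at hw
    by_cases hx : x ∈ flowSet G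
    · by_cases hy : y ∈ flowSet G
      · have hxy : a • x + b • y ∈ flowSet G :=
          convex_flowSet G hx hy a.coe_nonneg b.coe_nonneg (by exact_mod_cast hab)
        rw [flowIntegrand_of_mem G Θ c t hxy, flowIntegrand_of_mem G Θ c t hx,
          flowIntegrand_of_mem G Θ c t hy, mul_left_comm, mul_left_comm (b : ℝ≥0∞), ← mul_add]
        gcongr
        exact flowCost_convex G hΘ hx hy a b hab
      · rw [flowIntegrand_of_notMem G Θ ht hy, ENNReal.mul_top (by simpa using hb), add_top]
        exact le_top
    · rw [flowIntegrand_of_notMem G Θ ht hx, ENNReal.mul_top (by simpa using ha), top_add]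
      exact le_top
  coercive := by
    -- Densities contribute at most the number of vertices to the squared norm; fluxes contribute at
    -- most 4 times the unweighted cost, and undoing the weight 1/c² costs at most K².
    refine ⟨(Fintype.card V + 4 * K ^ 2).toNNReal, fun t ht x => ?_⟩
    by_cases hx : x ∈ flowSet G
    · have hct : 0 < c t ^ 2 := by have := hc0 t ht; positivity
      have hcost : flowCost G Θ x ≤ ENNReal.ofReal (K ^ 2) * flowIntegrand G Θ c t x := by
        rw [flowIntegrand_of_mem G Θ c t hx, ← mul_assoc, ← ENNReal.ofReal_mul (sq_nonneg K)]
        refine le_mul_of_one_le_left' ?_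
        rw [ENNReal.one_le_ofReal, mul_one_div, one_le_div hct]
        exact sq_le_sq' (by linarith [neg_abs_le (c t), hcK t ht])
          ((le_abs_self _).trans (hcK t ht))
      have hρ : ∑ i, densityCoord i x ^ 2 ≤ (Fintype.card V : ℝ) := by
        calc ∑ i, densityCoord i x ^ 2 ≤ ∑ _i : V, (1 : ℝ) :=
              Finset.sum_le_sum fun i _ => pow_le_one₀ (hx.1.1 i) (le_one_of_mem_stdSimplex hx.1 i)
          _ = Fintype.card V := by simp
      have hn : ‖x‖ₑ ^ (2 : ℝ) = ENNReal.ofReal (‖x‖ ^ 2) := by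
        rw [← ofReal_norm, ENNReal.ofReal_rpow_of_nonneg (norm_nonneg x) (by norm_num)]
        norm_num
      rw [hn, norm_sq_flowSpace]
      calc ENNReal.ofReal (∑ i, densityCoord i x ^ 2 + ∑ i, ∑ j, fluxCoord i j x ^ 2)
          ≤ ENNReal.ofReal (∑ i, densityCoord i x ^ 2)
            + ENNReal.ofReal (∑ i, ∑ j, fluxCoord i j x ^ 2) := ENNReal.ofReal_add_le
        _ ≤ ENNReal.ofReal (Fintype.card V)
            + 4 * (ENNReal.ofReal (K ^ 2) * flowIntegrand G Θ c t x) := by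
            gcongr
            exact (sum_sq_fluxCoord_le G hΘ hx).trans (by gcongr)
        _ = ENNReal.ofReal (Fintype.card V)
            + ENNReal.ofReal (4 * K ^ 2) * flowIntegrand G Θ c t x := by
            rw [ENNReal.ofReal_mul (by norm_num), mul_assoc]
            norm_num
        _ ≤ ENNReal.ofReal (Fintype.card V + 4 * K ^ 2) * 1
            + ENNReal.ofReal (Fintype.card V + 4 * K ^ 2) * flowIntegrand G Θ c t x := by
            rw [mul_one]
            gcongr
            · linarith [sq_nonneg K]
            · linarith [(Nat.cast_nonneg (Fintype.card V) : (0 : ℝ) ≤ _)]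
        _ = ENNReal.ofReal (Fintype.card V + 4 * K ^ 2) * (flowIntegrand G Θ c t x + 1) := by
            ring
    · rw [flowIntegrand_of_notMem G Θ (hc0 t ht) hx, top_add]
      by_cases hV : (Fintype.card V : ℝ) + 4 * K ^ 2 ≤ 0
      · have hcard : (0 : ℝ) ≤ Fintype.card V := Nat.cast_nonneg _
        have hK0 : K ^ 2 = 0 := by nlinarith [sq_nonneg K]
        have := hcK t ht
        have := abs_pos.2 (hc0 t ht)
        have : K ≠ 0 := by linarith
        exact absurd hK0 (by positivity)
      · rw [ENNReal.mul_top]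
        · exact le_top
        · simpa using hV

end Integrand

/-! ### Regular speeds and paths of finite energy -/

/-- A measurable speed which is bounded and bounded away from zero on `[0,1]`. -/
structure IsRegularSpeed (c : ℝ → ℝ) : Prop where
  measurable : Measurable c
  lower : ∃ k > 0, ∀ t ∈ Icc (0 : ℝ) 1, k ≤ |c t|
  upper : ∃ K, ∀ t ∈ Icc (0 : ℝ) 1, |c t| ≤ K

theorem IsRegularSpeed.ne_zero {c : ℝ → ℝ} (hc : IsRegularSpeed c) {t : ℝ}
    (ht : t ∈ Icc (0 : ℝ) 1) : c t ≠ 0 := by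
  obtain ⟨k, hk, h⟩ := hc.lower
  exact abs_pos.1 (hk.trans_le (h t ht))

theorem memLp_of_continuous {f : ℝ → ℝ} (hf : Continuous f) : MemLp f 2 unitVolume := by
  obtain ⟨C, hC⟩ := (isCompact_Icc (a := (0 : ℝ)) (b := 1)).exists_bound_of_continuousOn
    hf.continuousOn
  refine MemLp.of_bound hf.aestronglyMeasurable C ?_
  filter_upwards [ae_restrict_mem measurableSet_Icc] with t ht using hC t ht

section Flow

variable {V : Type*} [Fintype V] (G : SimpleGraph V) [DecidableRel G.Adj]

/-- Along a walk from `a` to `b` there is a unit flow. -/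
theorem exists_unit_flow [DecidableEq V] {a b : V} (p : G.Walk a b) :
    ∃ M : V → V → ℝ, (∀ k j, M k j = - M j k) ∧ (∀ k j, ¬ G.Adj k j → M k j = 0) ∧
      ∀ k, ∑ j ∈ G.neighborFinset k, M k j
        = (if k = a then 1 else 0) - (if k = b then 1 else 0) := by
  induction p with
  | nil => exact ⟨fun _ _ => 0, by simp, by simp, by simp⟩
  | @cons u v w h p ih =>
    obtain ⟨M, h1, h2, h3⟩ := ih
    refine ⟨fun k j => M k j + ((if k = u ∧ j = v then 1 else 0) - if k = v ∧ j = u then 1 else 0),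
      fun k j => ?_, fun k j hkj => ?_, fun k => ?_⟩
    · beta_reduce
      rw [h1 k j, if_congr (and_comm (a := j = u)) rfl rfl, if_congr (and_comm (a := j = v)) rfl rfl]
      ring
    · have e1 : ¬ (k = u ∧ j = v) := by
        rintro ⟨rfl, rfl⟩
        exact hkj h
      have e2 : ¬ (k = v ∧ j = u) := by
        rintro ⟨rfl, rfl⟩
        exact hkj h.symm
      simp [h2 k j hkj, e1, e2]
    · rw [Finset.sum_add_distrib, h3 k, Finset.sum_sub_distrib]
      have e1 : ∑ j ∈ G.neighborFinset k, (if k = u ∧ j = v then (1 : ℝ) else 0)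
          = if k = u then 1 else 0 := by
        by_cases hk : k = u
        · subst hk
          simp [h]
        · simp [hk]
      have e2 : ∑ j ∈ G.neighborFinset k, (if k = v ∧ j = u then (1 : ℝ) else 0)
          = if k = v then 1 else 0 := by
        by_cases hk : k = v
        · subst hk
          simp [h.symm]
        · simp [hk]
      rw [e1, e2]
      ring

/-- On a connected graph every vector with zero sum is the divergence of a flow that depends
linearly on it. -/
theorem exists_linear_flow (hG : G.Connected) :
    ∃ M : V → V → V → ℝ, (∀ i k j, M i k j = - M i j k) ∧
      (∀ i k j, ¬ G.Adj k j → M i k j = 0) ∧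
      ∀ v : V → ℝ, ∑ i, v i = 0 →
        ∀ k, ∑ j ∈ G.neighborFinset k, ∑ i, v i * M i k j = v k := by
  classical
  -- Every vertex sends its mass to a common root o; the contributions at o cancel because the
  -- vector has zero sum.
  obtain ⟨o⟩ := hG.nonempty
  have h : ∀ i, ∃ M : V → V → ℝ, (∀ k j, M k j = - M j k) ∧ (∀ k j, ¬ G.Adj k j → M k j = 0) ∧
      ∀ k, ∑ j ∈ G.neighborFinset k, M k j
        = (if k = i then 1 else 0) - (if k = o then 1 else 0) := fun i =>
    exists_unit_flow G (hG.preconnected i o).some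
  choose M h1 h2 h3 using h
  refine ⟨M, h1, h2, fun v hv k => ?_⟩
  rw [Finset.sum_comm]
  simp only [← Finset.mul_sum, h3, mul_sub, Finset.sum_sub_distrib, ← Finset.sum_mul, hv, zero_mul,
    sub_zero]
  simp

/-- Any two densities are joined by a path of finite energy. -/
theorem exists_controlled_finite_energy (hG : G.Connected) {Θ : ℝ → ℝ → ℝ} (hΘ : IsProbWeight Θ)
    {c : ℝ → ℝ} (hc : IsRegularSpeed c) {ρa ρb : V → ℝ} (ha : ρa ∈ stdSimplex ℝ V)
    (hb : ρb ∈ stdSimplex ℝ V) :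
    ∃ x, IsControlled densityCoord (fluxDiv G) ρa ρb x ∧
      ∫⁻ t, flowIntegrand G Θ c t (x t) ∂unitVolume ≠ ⊤ := by
  have := hG.nonempty
  obtain ⟨M, hskew, hsupp, hdiv⟩ := exists_linear_flow G hG
  set N : ℝ := (Fintype.card V : ℝ) with hN
  have hN0 : 0 < N := by
    rw [hN]
    exact_mod_cast Fintype.card_pos
  -- The cubic s has derivative 6t(1-t), and β = (t(1-t))² mixes in the uniform density. Then ρ' =
  -- t(1-t) r with r bounded on [0,1], while ρ_i ≥ (t(1-t))²/N. Flux squared over weight therefore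
  -- stays bounded even when the endpoints lie on the boundary of the simplex.
  let s : ℝ → ℝ := fun t => 3 * t ^ 2 - 2 * t ^ 3
  let β : ℝ → ℝ := fun t => (t * (1 - t)) ^ 2
  let w : ℝ → V → ℝ := fun t i => (1 - s t) * ρa i + s t * ρb i
  let ρ : ℝ → V → ℝ := fun t i => (1 - β t) * w t i + β t * N⁻¹
  let r : ℝ → V → ℝ := fun t i =>
    (1 - β t) * (6 * (ρb i - ρa i)) + 2 * (1 - 2 * t) * (N⁻¹ - w t i)
  let Q : ℝ → V → V → ℝ := fun t k j => ∑ i, - r t i * M i k j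
  let x : ℝ → FlowSpace V := fun t =>
    WithLp.toLp 2 (Sum.elim (ρ t) fun p => t * (1 - t) * Q t p.1 p.2)
  have hNsum : ∑ _i : V, N⁻¹ = 1 := by
    rw [Finset.sum_const, Finset.card_univ, nsmul_eq_mul]
    exact mul_inv_cancel₀ hN0.ne'
  have hw : ∀ t ∈ Icc (0 : ℝ) 1, w t ∈ stdSimplex ℝ V := by
    intro t ht
    refine convex_stdSimplex ℝ V ha hb (a := 1 - s t) (b := s t) ?_ ?_ (by ring)
    · have : 1 - s t = (1 - t) ^ 2 * (1 + 2 * t) := by simp only [s]; ring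
      rw [this]
      have := ht.1
      positivity
    · have : s t = t ^ 2 * (3 - 2 * t) := by simp only [s]; ring
      rw [this]
      have := ht.2
      exact mul_nonneg (sq_nonneg t) (by linarith)
  have hβ : ∀ t ∈ Icc (0 : ℝ) 1, β t ≤ 1 := by
    intro t ht
    refine pow_le_one₀ (mul_nonneg ht.1 (by linarith [ht.2])) ?_
    nlinarith [ht.1, ht.2]
  have hρ : ∀ t ∈ Icc (0 : ℝ) 1, ρ t ∈ stdSimplex ℝ V := by
    intro t ht
    refine convex_stdSimplex ℝ V (hw t ht) (y := fun _ => N⁻¹) ⟨fun _ => by positivity, hNsum⟩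
      (a := 1 - β t) (b := β t) (by linarith [hβ t ht]) (sq_nonneg _) (by ring)
  have hwsum : ∀ t, ∑ i, w t i = 1 := by
    intro t
    simp only [w, Finset.sum_add_distrib, ← Finset.mul_sum, ha.2, hb.2]
    ring
  have hrsum : ∀ t, ∑ i, - r t i = 0 := by
    intro t
    rw [Finset.sum_neg_distrib, neg_eq_zero]
    simp only [r, Finset.sum_add_distrib, ← Finset.mul_sum, Finset.sum_sub_distrib, ha.2, hb.2,
      hNsum, hwsum]
    ring
  have hx1 : ∀ t i, densityCoord i (x t) = ρ t i := fun t i => rfl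
  have hx2 : ∀ t k j, fluxCoord k j (x t) = t * (1 - t) * Q t k j := fun t k j => rfl
  have hxD : ∀ t i, fluxDiv G i (x t) = - (t * (1 - t) * r t i) := by
    intro t i
    rw [fluxDiv_apply]
    simp only [hx2]
    rw [← Finset.mul_sum, hdiv (fun i => - r t i) (hrsum t) i]
    ring
  have hderiv : ∀ i t, HasDerivAt (fun t => ρ t i) (t * (1 - t) * r t i) t := by
    intro i t
    have hs : HasDerivAt s (6 * (t * (1 - t))) t := by
      have h := ((hasDerivAt_pow 2 t).const_mul 3).sub ((hasDerivAt_pow 3 t).const_mul 2)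
      refine h.congr_deriv ?_
      push_cast
      ring
    have hβ : HasDerivAt β (2 * (t * (1 - t)) * (1 - 2 * t)) t := by
      have h := ((hasDerivAt_id t).mul ((hasDerivAt_id t).const_sub 1)).pow 2
      refine h.congr_deriv ?_
      simp only [Pi.mul_apply, id]
      push_cast
      ring
    have hw : HasDerivAt (fun t => w t i) (6 * (t * (1 - t)) * (ρb i - ρa i)) t := by
      have h := ((hs.const_sub 1).mul_const (ρa i)).add (hs.mul_const (ρb i))
      refine h.congr_deriv ?_
      ring
    have h := ((hβ.const_sub 1).mul hw).add (hβ.mul_const N⁻¹)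
    refine h.congr_deriv ?_
    simp only [r]
    ring
  have hrc : ∀ i, Continuous fun t => r t i := by
    intro i
    simp only [r, w, s, β]
    fun_prop
  have hρc : ∀ i, Continuous fun t => ρ t i := by
    intro i
    simp only [ρ, w, s, β]
    fun_prop
  have hQc : ∀ k j, Continuous fun t => Q t k j := fun k j =>
    continuous_finsetSum _ fun i _ => (hrc i).neg.mul_const _
  have hpath : ∀ i t, ∫ s in (0 : ℝ)..t, fluxDiv G i (x s) = ρa i - ρ t i := by
    intro i t
    simp only [hxD]
    rw [intervalIntegral.integral_neg, intervalIntegral.integral_eq_sub_of_hasDerivAt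
      (fun t _ => hderiv i t)]
    · simp [ρ, w, s, β]
    · refine Continuous.intervalIntegrable ?_ _ _
      have := hrc i
      fun_prop
  refine ⟨x, ⟨?_, fun i => ae_of_all _ fun t => ?_, fun i => ?_⟩, ?_⟩
  · refine memLp_piLp_iff.2 fun p => ?_
    rcases p with i | ⟨k, j⟩
    · exact memLp_of_continuous (hρc i)
    · refine memLp_of_continuous ?_
      have := hQc k j
      exact (by fun_prop : Continuous fun t : ℝ => t * (1 - t) * Q t k j)
  · rw [hpath, hx1]
    ring
  · rw [hpath]
    simp [ρ, w, s, β]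
    ring
  · have hQb : ∀ k j, ∃ C, ∀ t ∈ Icc (0 : ℝ) 1, ‖Q t k j‖ ≤ C := fun k j =>
      isCompact_Icc.exists_bound_of_continuousOn (hQc k j).continuousOn
    choose C hC using hQb
    obtain ⟨κ, hκ, hκc⟩ := hc.lower
    set B : ℝ≥0∞ := ENNReal.ofReal (1 / κ ^ 2) * ((1 / 4) * ∑ i, ∑ j ∈ G.neighborFinset i,
      ENNReal.ofReal (C i j ^ 2 / N⁻¹)) with hB
    have hBtop : B ≠ ⊤ := by
      refine ENNReal.mul_ne_top ENNReal.ofReal_ne_top (ENNReal.mul_ne_top (by simp) ?_)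
      exact ENNReal.sum_ne_top.2 fun i _ => ENNReal.sum_ne_top.2 fun j _ => ENNReal.ofReal_ne_top
    refine ne_top_of_le_ne_top hBtop ?_
    calc ∫⁻ t, flowIntegrand G Θ c t (x t) ∂unitVolume ≤ ∫⁻ _t, B ∂unitVolume := by
          refine lintegral_mono_ae ?_
          filter_upwards [ae_restrict_mem measurableSet_Icc] with t ht
          have hmem : x t ∈ flowSet G := by
            refine ⟨hρ t ht, fun k j => ?_, fun k j hkj => ?_⟩
            · rw [hx2, hx2, ← mul_neg]
              simp only [Q, ← Finset.sum_neg_distrib]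
              congr 1
              refine Finset.sum_congr rfl fun i _ => ?_
              rw [hskew i k j]
              ring
            · rw [hx2]
              simp [Q, hsupp _ k j hkj]
          rw [flowIntegrand_of_mem G Θ c t hmem, flowCost_of_mem G Θ hmem, hB]
          have hsq : κ ^ 2 ≤ c t ^ 2 := by
            rw [← sq_abs (c t)]
            exact pow_le_pow_left₀ hκ.le (hκc t ht) 2
          gcongr with i _ j _
          rw [hx2, hx1, hx1]
          have hlow : ∀ i, (t * (1 - t)) ^ 2 * N⁻¹ ≤ ρ t i := by
            intro i
            have h1 := mul_nonneg (sub_nonneg.2 (hβ t ht)) ((hw t ht).1 i)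
            simp only [ρ, β] at h1 ⊢
            linarith
          refine (edgeCost_le_of_sq_mul_le (inv_pos.2 hN0) ((le_min (hlow i) (hlow j)).trans
            (hΘ.min_le _ _ ((hρ t ht).1 i) ((hρ t ht).1 j))) _).trans ?_
          refine ENNReal.ofReal_le_ofReal ?_
          have h2 : Q t i j ^ 2 ≤ C i j ^ 2 := by
            rw [← sq_abs (Q t i j)]
            exact pow_le_pow_left₀ (abs_nonneg _) (hC i j t ht) 2
          gcongr
      _ = B := by rw [lintegral_const, measure_univ, mul_one]

end Flow

/-! ### From controlled paths back to feasible pairs -/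

section Feasible

variable {V : Type*} [Fintype V] (G : SimpleGraph V) [DecidableRel G.Adj]

/-- A controlled path of finite energy yields a feasible pair of the same action. -/
theorem exists_feasible_of_controlled {Θ : ℝ → ℝ → ℝ} {wdot : ℝ → ℝ}
    (hc : IsRegularSpeed fun t => 1 + wdot t) {ρa ρb : V → ℝ} {x : ℝ → FlowSpace V}
    (hx : IsControlled densityCoord (fluxDiv G) ρa ρb x)
    (hfin : ∫⁻ t, flowIntegrand G Θ (fun t => 1 + wdot t) t (x t) ∂unitVolume ≠ ⊤)
    (hmeas : AEMeasurable (fun t => flowIntegrand G Θ (fun t => 1 + wdot t) t (x t)) unitVolume) :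
    ∃ ρ m, IsFeasible G wdot ρa ρb ρ m ∧
      action G Θ ρ m = ∫⁻ t, flowIntegrand G Θ (fun t => 1 + wdot t) t (x t) ∂unitVolume := by
  have hmem : ∀ᵐ t ∂unitVolume, x t ∈ flowSet G := by
    filter_upwards [ae_lt_top' hmeas hfin, ae_restrict_mem measurableSet_Icc] with t h1 ht
    exact mem_flowSet_of_flowIntegrand_ne_top G Θ (c := fun t => 1 + wdot t) (hc.ne_zero ht) h1.ne
  have hDint : ∀ i, Integrable (fun t => - fluxDiv G i (x t)) unitVolume := fun i =>
    (integrable_of_memLp ((fluxDiv G i).comp_memLp' hx.memLp)).neg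
  set ρ : ℝ → V → ℝ := fun t i => ρa i + ∫ s in (0 : ℝ)..t, - fluxDiv G i (x s) with hρ
  have hρx : ∀ᵐ t ∂unitVolume, ρ t = fun i => densityCoord i (x t) := by
    filter_upwards [ae_all_iff.2 hx.path] with t ht
    ext i
    rw [ht i, hρ]
    simp only [intervalIntegral.integral_neg]
    ring
  have hprim : ∀ i, IsPrimitive (fun t => ρ t i) (fun t => - fluxDiv G i (x t)) := fun i =>
    isPrimitive_intervalIntegral (hDint i) (ρa i)
  have hsimplex : ∀ t ∈ Icc (0 : ℝ) 1, ρ t ∈ stdSimplex ℝ V := by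
    -- Nonnegativity is phrased as an equality of continuous functions so that it passes from almost
    -- every time to every time.
    have h1 : ∀ i, EqOn (fun t => max (- ρ t i) 0) (fun _ => 0) (Icc (0 : ℝ) 1) := by
      intro i
      refine Measure.eqOn_Icc_of_ae_eq volume zero_ne_one ?_ ?_ continuousOn_const
      · filter_upwards [hρx, hmem] with t h1 h2
        rw [h1]
        exact max_eq_right (by simpa using h2.1.1 i)
      · exact ((hprim i).continuousOn.neg.sup continuousOn_const)
    have h2 : EqOn (fun t => ∑ i, ρ t i) (fun _ => 1) (Icc (0 : ℝ) 1) := by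
      refine Measure.eqOn_Icc_of_ae_eq volume zero_ne_one ?_ ?_ continuousOn_const
      · filter_upwards [hρx, hmem] with t h1 h2
        rw [h1]
        exact h2.1.2
      · exact continuousOn_finsetSum _ fun i _ => (hprim i).continuousOn
    exact fun t ht => ⟨fun i => by simpa using h1 i ht, h2 ht⟩
  obtain ⟨k, hk, hkc⟩ := hc.lower
  -- Dividing by 1 + Ẇ undoes the change of flux; the lower bound on the speed keeps the result in
  -- L².
  refine ⟨ρ, fun t i j => (1 + wdot t)⁻¹ * fluxCoord i j (x t), ⟨hsimplex, ?_, ?_, fun i j => ?_, ?_,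
    ⟨fun t i => - fluxDiv G i (x t), hasH1Deriv_of_isPrimitive hprim fun i => ?_, ?_⟩⟩, ?_⟩
  · ext i
    simp [hρ]
  · ext i
    rw [hx.final i]
    simp [hρ, sub_eq_add_neg]
  · refine MemLp.of_le_mul (c := k⁻¹) ((fluxCoord i j).comp_memLp' hx.memLp) ?_ ?_
    · exact hc.measurable.inv.aestronglyMeasurable.mul
        ((fluxCoord i j).comp_memLp' hx.memLp).aestronglyMeasurable
    · filter_upwards [ae_restrict_mem measurableSet_Icc] with t ht
      rw [norm_mul, norm_inv]
      have := hkc t ht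
      gcongr
      · exact this
      · rfl
  · filter_upwards [hmem] with t ht i j
    rw [ht.2.1 i j]
    ring
  · exact ((fluxDiv G i).comp_memLp' hx.memLp).neg
  · filter_upwards [ae_restrict_mem measurableSet_Icc] with t ht i
    rw [← Finset.mul_sum, ← fluxDiv_apply]
    have := hc.ne_zero ht
    field_simp
    ring
  · refine lintegral_congr_ae ?_
    filter_upwards [hρx, hmem, ae_restrict_mem measurableSet_Icc] with t h1 h2 ht
    have hne := hc.ne_zero ht
    rw [flowIntegrand_of_mem G Θ _ t h2, flowCost_of_mem G Θ h2, h1, mul_left_comm]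
    congr 1
    simp only [Finset.mul_sum]
    refine Finset.sum_congr rfl fun i _ => Finset.sum_congr rfl fun j _ => ?_
    rw [edgeCost_mul (inv_ne_zero hne), inv_pow, one_div]

end Feasible

theorem ofReal_integral_le_lintegral_ofReal {α : Type*} [MeasurableSpace α] {μ : Measure α}
    {f : α → ℝ} (hf : Integrable f μ) :
    ENNReal.ofReal (∫ t, f t ∂μ) ≤ ∫⁻ t, ENNReal.ofReal (f t) ∂μ := by
  calc ENNReal.ofReal (∫ t, f t ∂μ) ≤ ENNReal.ofReal (∫ t, max (f t) 0 ∂μ) :=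
        ENNReal.ofReal_le_ofReal (integral_mono hf hf.pos_part fun t => le_max_left _ _)
    _ = ∫⁻ t, ENNReal.ofReal (max (f t) 0) ∂μ :=
        ofReal_integral_eq_lintegral_ofReal hf.pos_part (ae_of_all _ fun t => le_max_right _ _)
    _ = ∫⁻ t, ENNReal.ofReal (f t) ∂μ := by simp

theorem ofReal_sum_le_sum_ofReal {ι : Type*} (s : Finset ι) (f : ι → ℝ) :
    ENNReal.ofReal (∑ i ∈ s, f i) ≤ ∑ i ∈ s, ENNReal.ofReal (f i) :=
  Finset.le_sum_of_subadditive ENNReal.ofReal ENNReal.ofReal_zero.le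
    (fun _ _ => ENNReal.ofReal_add_le) s f

/-! ### Weak duality -/

section Weak

variable {V : Type*} [Fintype V] (G : SimpleGraph V) [DecidableRel G.Adj]

/-- Summation by parts on a graph. -/
theorem sum_mul_div_of_skew (s : V → ℝ) {m : V → V → ℝ} (hm : ∀ i j, m i j = - m j i) :
    ∑ i, s i * ∑ j ∈ G.neighborFinset i, m i j
      = (1 / 2) * ∑ i, ∑ j ∈ G.neighborFinset i, (s i - s j) * m i j := by
  have h : ∑ i, ∑ j ∈ G.neighborFinset i, s j * m i j
      = - ∑ i, ∑ j ∈ G.neighborFinset i, s i * m i j := by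
    rw [Finset.sum_comm' (t' := Finset.univ) (s' := fun j => G.neighborFinset j)
      (by simp [SimpleGraph.adj_comm]), ← Finset.sum_neg_distrib]
    refine Finset.sum_congr rfl fun i _ => ?_
    rw [← Finset.sum_neg_distrib]
    refine Finset.sum_congr rfl fun j _ => ?_
    rw [hm j i]
    ring
  simp only [sub_mul, Finset.sum_sub_distrib, h, Finset.mul_sum]
  ring

/-- Weak duality. -/
theorem ofReal_dual_le_action {Θ : ℝ → ℝ → ℝ} {wdot : ℝ → ℝ} {ρa ρb : V → ℝ} {ρ : ℝ → V → ℝ}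
    {m : ℝ → V → V → ℝ} {S S' : ℝ → V → ℝ} (hρ : IsFeasible G wdot ρa ρb ρ m)
    (hS : IsDualAdmissible G Θ wdot S S') :
    ENNReal.ofReal (∑ i, S 1 i * ρb i - ∑ i, S 0 i * ρa i) ≤ action G Θ ρ m := by
  obtain ⟨ρ', hρ', hcont⟩ := hρ.continuity
  have hint : ∀ i, Integrable (fun t => S' t i * ρ t i + S t i * ρ' t i) unitVolume := by
    intro i
    refine Integrable.add ?_ ((hS.h1.isPrimitive i).integrable_mul (hρ'.isPrimitive i).integrable)
    have := (hρ'.isPrimitive i).integrable_mul (hS.h1.isPrimitive i).integrable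
    simpa only [mul_comm] using this
  have hval : ∑ i, S 1 i * ρb i - ∑ i, S 0 i * ρa i
      = ∫ t, ∑ i, (S' t i * ρ t i + S t i * ρ' t i) ∂unitVolume := by
    rw [integral_finsetSum _ fun i _ => hint i, ← Finset.sum_sub_distrib, ← hρ.init, ← hρ.final]
    refine Finset.sum_congr rfl fun i _ => ?_
    exact ((hS.h1.isPrimitive i).integral_by_parts (hρ'.isPrimitive i)).symm
  rw [hval]
  refine (ofReal_integral_le_lintegral_ofReal (integrable_finsetSum _ fun i _ => hint i)).trans ?_
  refine lintegral_mono_ae ?_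
  filter_upwards [hcont, hρ.skew, hS.isLUB, ae_restrict_mem measurableSet_Icc] with t h1 h2 h3 ht
  have hH : hamiltonJacobi G Θ (wdot t) (S' t) (S t) (ρ t) ≤ 0 :=
    h3.1 (mem_image_of_mem _ (hρ.mem_simplex t ht))
  -- On each edge the affine minorant of the cost is taken with slope b = -(1 + Ẇ)(S_i - S_j). Its
  -- quadratic part is the Hamiltonian term, and its linear part is the pairing of S with ρ' after
  -- summation by parts.
  have hle : ∑ i, (S' t i * ρ t i + S t i * ρ' t i)
      ≤ (1 / 4) * ∑ i, ∑ j ∈ G.neighborFinset i,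
        (2 * (-(1 + wdot t) * (S t i - S t j)) * m t i j
          - (-(1 + wdot t) * (S t i - S t j)) ^ 2 * Θ (ρ t i) (ρ t j)) := by
    have e1 : ∑ i, S t i * ρ' t i
        = -(1 + wdot t) * ∑ i, S t i * ∑ j ∈ G.neighborFinset i, m t i j := by
      rw [Finset.mul_sum]
      refine Finset.sum_congr rfl fun i _ => ?_
      have : ρ' t i = -(1 + wdot t) * ∑ j ∈ G.neighborFinset i, m t i j := by linarith [h1 i]
      rw [this]
      ring
    have e2 : (1 / 4) * ∑ i, ∑ j ∈ G.neighborFinset i,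
        (2 * (-(1 + wdot t) * (S t i - S t j)) * m t i j
          - (-(1 + wdot t) * (S t i - S t j)) ^ 2 * Θ (ρ t i) (ρ t j))
        = -(1 + wdot t) * ((1 / 2) * ∑ i, ∑ j ∈ G.neighborFinset i, (S t i - S t j) * m t i j)
          - (1 / 4) * ∑ i, ∑ j ∈ G.neighborFinset i,
            (S t i - S t j) ^ 2 * Θ (ρ t i) (ρ t j) * (1 + wdot t) ^ 2 := by
      simp only [Finset.mul_sum, ← Finset.sum_sub_distrib]
      refine Finset.sum_congr rfl fun i _ => Finset.sum_congr rfl fun j _ => ?_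
      ring
    rw [e2, Finset.sum_add_distrib, e1, sum_mul_div_of_skew G (S t) h2]
    rw [hamiltonJacobi] at hH
    linarith
  refine (ENNReal.ofReal_le_ofReal hle).trans ?_
  have h4 : ENNReal.ofReal (1 / 4) = 1 / 4 := by
    rw [ENNReal.ofReal_div_of_pos (by norm_num)]
    simp
  rw [ENNReal.ofReal_mul (by norm_num), h4]
  gcongr
  refine (ofReal_sum_le_sum_ofReal _ _).trans (Finset.sum_le_sum fun i _ => ?_)
  refine (ofReal_sum_le_sum_ofReal _ _).trans (Finset.sum_le_sum fun j _ => ?_)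
  exact ofReal_le_edgeCost _ _ _

end Weak

/-! ### The Hamiltonian and its near-optimal flows -/

section Strong

variable {V : Type*} [Fintype V] (G : SimpleGraph V) [DecidableRel G.Adj]

theorem continuousOn_hamiltonJacobi {Θ : ℝ → ℝ → ℝ} (hΘ : IsProbWeight Θ) (x : ℝ) (a s : V → ℝ) :
    ContinuousOn (hamiltonJacobi G Θ x a s) (stdSimplex ℝ V) := by
  refine ContinuousOn.add (by fun_prop) (continuousOn_const.mul ?_)
  refine continuousOn_finsetSum _ fun i _ => continuousOn_finsetSum _ fun j _ => ?_
  refine (continuousOn_const.mul ?_).mul continuousOn_const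
  have h1 : ContinuousOn (fun r : V → ℝ => (r i, r j)) (stdSimplex ℝ V) := by fun_prop
  exact hΘ.cont.comp h1 fun r hr => ⟨hr.1 i, hr.1 j⟩

/-- Potential differences do not see a constant, and densities have total mass one. This is what
allows a potential to be normalized to maximum zero. -/
theorem hamiltonJacobi_sub (Θ : ℝ → ℝ → ℝ) (x h k : ℝ) (a s : V → ℝ) {r : V → ℝ}
    (hr : r ∈ stdSimplex ℝ V) :
    hamiltonJacobi G Θ x (fun i => a i - h) (fun i => s i - k) r
      = hamiltonJacobi G Θ x a s r - h := by
  simp only [hamiltonJacobi, sub_mul, Finset.sum_sub_distrib, ← Finset.mul_sum, hr.2,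
    sub_sub_sub_cancel_right]
  ring

/-- Supplies an L² majorant for the maximal Hamiltonian, since S is bounded on [0,1] and S' is in
L². -/
theorem abs_hamiltonJacobi_le {Θ : ℝ → ℝ → ℝ} (hΘ : IsProbWeight Θ) {x K : ℝ} (hx : |1 + x| ≤ K)
    (a : V → ℝ) {s : V → ℝ} {B : ℝ} (hs : ∀ i, |s i| ≤ B) {r : V → ℝ} (hr : r ∈ stdSimplex ℝ V) :
    |hamiltonJacobi G Θ x a s r|
      ≤ ∑ i, |a i| + (1 / 4) * ∑ _i : V, ∑ _j : V, (2 * B) ^ 2 * 1 * K ^ 2 := by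
  refine (abs_add_le _ _).trans (add_le_add ?_ ?_)
  · refine (Finset.abs_sum_le_sum_abs _ _).trans (Finset.sum_le_sum fun i _ => ?_)
    rw [abs_mul, abs_of_nonneg (hr.1 i)]
    exact mul_le_of_le_one_right (abs_nonneg _) (le_one_of_mem_stdSimplex hr i)
  · have hθ0 : ∀ i j, 0 ≤ Θ (r i) (r j) := fun i j => hΘ.nonneg (hr.1 i) (hr.1 j)
    rw [abs_of_nonneg (mul_nonneg (by norm_num) (Finset.sum_nonneg fun i _ =>
      Finset.sum_nonneg fun j _ => by have := hθ0 i j; positivity))]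
    gcongr with i _
    refine (Finset.sum_le_sum_of_subset_of_nonneg (Finset.subset_univ _) fun j _ _ => by
      have := hθ0 i j; positivity).trans (Finset.sum_le_sum fun j _ => ?_)
    have h1 : (s i - s j) ^ 2 ≤ (2 * B) ^ 2 := by
      rw [← sq_abs (s i - s j)]
      refine pow_le_pow_left₀ (abs_nonneg _) ((abs_sub _ _).trans ?_) 2
      linarith [hs i, hs j]
    have h2 : (1 + x) ^ 2 ≤ K ^ 2 := by
      rw [← sq_abs (1 + x)]
      exact pow_le_pow_left₀ (abs_nonneg _) hx 2
    have h3 : Θ (r i) (r j) ≤ 1 := hΘ.le_one (hr.1 i) (hr.1 j) (le_one_of_mem_stdSimplex hr i)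
      (le_one_of_mem_stdSimplex hr j)
    have := hθ0 i j
    gcongr

theorem measurable_hamiltonJacobi (Θ : ℝ → ℝ → ℝ) {x : ℝ → ℝ} {a s : V → ℝ → ℝ} (hx : Measurable x)
    (ha : ∀ i, Measurable (a i)) (hs : ∀ i, Measurable (s i)) (r : V → ℝ) :
    Measurable fun t => hamiltonJacobi G Θ (x t) (fun i => a i t) (fun i => s i t) r := by
  unfold hamiltonJacobi
  fun_prop

/-- The flux which is optimal for a given density and potential. -/
noncomputable def optimalFlow (Θ : ℝ → ℝ → ℝ) (c : ℝ) (s r : V → ℝ) : FlowSpace V :=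
  WithLp.toLp 2 (Sum.elim r fun p =>
    if G.Adj p.1 p.2 then -(c ^ 2 * (s p.1 - s p.2)) * Θ (r p.1) (r p.2) else 0)

omit [Fintype V] in
theorem densityCoord_optimalFlow (Θ : ℝ → ℝ → ℝ) (c : ℝ) (s r : V → ℝ) (i : V) :
    densityCoord i (optimalFlow G Θ c s r) = r i := rfl

omit [Fintype V] in
theorem fluxCoord_optimalFlow (Θ : ℝ → ℝ → ℝ) (c : ℝ) (s r : V → ℝ) (i j : V) :
    fluxCoord i j (optimalFlow G Θ c s r)
      = if G.Adj i j then -(c ^ 2 * (s i - s j)) * Θ (r i) (r j) else 0 := rfl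

theorem optimalFlow_mem_flowSet {Θ : ℝ → ℝ → ℝ} (hΘ : IsProbWeight Θ) (c : ℝ) (s : V → ℝ)
    {r : V → ℝ} (hr : r ∈ stdSimplex ℝ V) : optimalFlow G Θ c s r ∈ flowSet G := by
  refine ⟨hr, fun i j => ?_, fun i j hij => ?_⟩
  · rw [fluxCoord_optimalFlow, fluxCoord_optimalFlow, hΘ.symm _ _ (hr.1 i) (hr.1 j)]
    by_cases h : G.Adj i j
    · rw [if_pos h, if_pos h.symm]
      ring
    · rw [if_neg h, if_neg fun h' => h h'.symm, neg_zero]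
  · rw [fluxCoord_optimalFlow, if_neg hij]

/-- This is the equality case of Young's inequality: the pairing equals minus twice the energy
computed in `flowIntegrand_optimalFlow`. -/
theorem sum_mul_fluxDiv_optimalFlow {Θ : ℝ → ℝ → ℝ} (hΘ : IsProbWeight Θ) (c : ℝ) (s : V → ℝ)
    {r : V → ℝ} (hr : r ∈ stdSimplex ℝ V) :
    ∑ i, s i * fluxDiv G i (optimalFlow G Θ c s r)
      = - ((1 / 2) * ∑ i, ∑ j ∈ G.neighborFinset i, (s i - s j) ^ 2 * Θ (r i) (r j) * c ^ 2) := by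
  simp only [fluxDiv_apply]
  rw [sum_mul_div_of_skew G s (m := fun i j => fluxCoord i j (optimalFlow G Θ c s r))
    (optimalFlow_mem_flowSet G hΘ c s hr).2.1, ← mul_neg, ← Finset.sum_neg_distrib]
  congr 1
  refine Finset.sum_congr rfl fun i _ => ?_
  rw [← Finset.sum_neg_distrib]
  refine Finset.sum_congr rfl fun j hj => ?_
  rw [fluxCoord_optimalFlow, if_pos (by simpa using hj)]
  ring

theorem flowIntegrand_optimalFlow {Θ : ℝ → ℝ → ℝ} (hΘ : IsProbWeight Θ) {c : ℝ → ℝ} {t : ℝ}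
    (hc : c t ≠ 0) (s : V → ℝ) {r : V → ℝ} (hr : r ∈ stdSimplex ℝ V) :
    flowIntegrand G Θ c t (optimalFlow G Θ (c t) s r)
      = ENNReal.ofReal ((1 / 4) * ∑ i, ∑ j ∈ G.neighborFinset i,
          (s i - s j) ^ 2 * Θ (r i) (r j) * c t ^ 2) := by
  have hmem := optimalFlow_mem_flowSet G hΘ (c t) s hr
  have h4 : ENNReal.ofReal (1 / 4) = 1 / 4 := by
    rw [ENNReal.ofReal_div_of_pos (by norm_num)]
    simp
  have hθ0 : ∀ i j, 0 ≤ Θ (r i) (r j) := fun i j => hΘ.nonneg (hr.1 i) (hr.1 j)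
  rw [flowIntegrand_of_mem G Θ c t hmem, flowCost_of_mem G Θ hmem, mul_left_comm,
    ENNReal.ofReal_mul (by norm_num), h4,
    ENNReal.ofReal_sum_of_nonneg fun i _ => Finset.sum_nonneg fun j _ => by
      have := hθ0 i j; positivity, Finset.mul_sum]
  congr 1
  refine Finset.sum_congr rfl fun i _ => ?_
  rw [ENNReal.ofReal_sum_of_nonneg fun j _ => by have := hθ0 i j; positivity, Finset.mul_sum]
  refine Finset.sum_congr rfl fun j hj => ?_
  rw [fluxCoord_optimalFlow, if_pos (by simpa using hj), densityCoord_optimalFlow,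
    densityCoord_optimalFlow, edgeCost_mul_self (hθ0 i j),
    ← ENNReal.ofReal_mul (by positivity)]
  congr 1
  field_simp

/-- The maximum of the Hamiltonian over the simplex, together with a measurable near-optimal
selection. -/
theorem exists_isLUB_and_selection [Nonempty V] {Θ : ℝ → ℝ → ℝ} (hΘ : IsProbWeight Θ)
    {x : ℝ → ℝ} {a s : V → ℝ → ℝ} (hx : Measurable x)
    (ha : ∀ i, Measurable (a i)) (hs : ∀ i, Measurable (s i)) {ε : ℝ} (hε : 0 < ε) :
    ∃ h : ℝ → ℝ, Measurable h ∧
      (∀ t, IsLUB (hamiltonJacobi G Θ (x t) (fun i => a i t) (fun i => s i t) '' stdSimplex ℝ V)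
        (h t)) ∧
      ∃ r : ℝ → V → ℝ, Measurable r ∧ (∀ t, r t ∈ stdSimplex ℝ V) ∧ ∀ t,
        h t - ε ≤ hamiltonJacobi G Θ (x t) (fun i => a i t) (fun i => s i t) (r t) := by
  classical
  have : Nonempty (stdSimplex ℝ V) := ⟨⟨_, single_mem_stdSimplex ℝ (Classical.arbitrary V)⟩⟩
  -- By continuity the maximum over the simplex is a supremum over a countable dense set, hence
  -- measurable in t; choosing the first ε-optimal index gives a measurable selection.
  let d : ℕ → stdSimplex ℝ V := TopologicalSpace.denseSeq _
  have hd : DenseRange d := TopologicalSpace.denseRange_denseSeq _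
  set H : ℝ → (V → ℝ) → ℝ :=
    fun t => hamiltonJacobi G Θ (x t) (fun i => a i t) (fun i => s i t) with hH
  have hHc : ∀ t, Continuous fun r : stdSimplex ℝ V => H t r := fun t =>
    continuousOn_iff_continuous_domRestrict.1 (continuousOn_hamiltonJacobi G hΘ _ _ _)
  have hHm : ∀ r, Measurable fun t => H t r := measurable_hamiltonJacobi G Θ hx ha hs
  have hbdd : ∀ t, BddAbove (H t '' stdSimplex ℝ V) := fun t =>
    (isCompact_stdSimplex ℝ V).bddAbove_image (continuousOn_hamiltonJacobi G hΘ _ _ _)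
  have hbdd' : ∀ t, BddAbove (range fun n => H t (d n)) := fun t => (hbdd t).mono (by
    rintro _ ⟨n, rfl⟩
    exact mem_image_of_mem _ (d n).2)
  set h : ℝ → ℝ := fun t => ⨆ n, H t (d n) with hh
  have hmeas : Measurable h := Measurable.iSup fun n => hHm (d n)
  have hlub : ∀ t, IsLUB (H t '' stdSimplex ℝ V) (h t) := by
    intro t
    refine ⟨?_, fun b hb => ciSup_le fun n => hb (mem_image_of_mem _ (d n).2)⟩
    rintro _ ⟨r, hr, rfl⟩
    have hcl : IsClosed {q : stdSimplex ℝ V | H t q ≤ h t} := isClosed_le (hHc t) continuous_const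
    exact hd.induction_on (p := fun q : stdSimplex ℝ V => H t q ≤ h t) ⟨r, hr⟩ hcl
      fun n => le_ciSup (hbdd' t) n
  have hfind : ∀ t, ∃ n, h t - ε ≤ H t (d n) := by
    intro t
    obtain ⟨n, hn⟩ := exists_lt_of_lt_ciSup (show h t - ε < ⨆ n, H t (d n) by simp only [hh]; linarith)
    exact ⟨n, hn.le⟩
  refine ⟨h, hmeas, hlub, fun t => d (Nat.find (hfind t)), ?_, fun t => (d _).2,
    fun t => Nat.find_spec (hfind t)⟩
  have hN : Measurable fun t => Nat.find (hfind t) :=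
    measurable_find hfind fun n => measurableSet_le (hmeas.sub_const ε) (hHm (d n))
  exact (measurable_from_nat (f := fun n => (d n : V → ℝ))).comp hN

theorem measurable_optimalFlow {Θ : ℝ → ℝ → ℝ} (hΘ : IsProbWeight Θ) {c : ℝ → ℝ} {s : V → ℝ → ℝ}
    {r : ℝ → V → ℝ} (hc : Measurable c) (hs : ∀ i, Measurable (s i)) (hr : Measurable r)
    (hr' : ∀ t, r t ∈ stdSimplex ℝ V) :
    Measurable fun t => optimalFlow G Θ (c t) (fun i => s i t) (r t) := by
  have hrm : ∀ i, Measurable fun t => r t i := fun i => (measurable_pi_apply i).comp hr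
  refine (WithLp.measurable_toLp 2 _).comp (measurable_pi_iff.2 fun p => ?_)
  rcases p with i | ⟨i, j⟩
  · exact hrm i
  · by_cases hij : G.Adj i j
    · simp only [Sum.elim_inr, if_pos hij]
      have hθ : Measurable fun t => Θ (r t i) (r t j) := by
        have h1 := (hΘ.continuous_posPart (X := ℝ × ℝ) continuous_fst continuous_snd).measurable.comp
          ((hrm i).prodMk (hrm j))
        simpa only [Function.comp_def, max_eq_left ((hr' _).1 _)] using h1
      exact (((hc.pow_const 2).mul ((hs i).sub (hs j))).neg).mul hθ
    · simp only [Sum.elim_inr, if_neg hij]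
      exact measurable_const

theorem norm_optimalFlow_coord_le {Θ : ℝ → ℝ → ℝ} (hΘ : IsProbWeight Θ) {c K B : ℝ} (hc : |c| ≤ K)
    {s r : V → ℝ} (hs : ∀ i, |s i| ≤ B) (hr : r ∈ stdSimplex ℝ V) (p : V ⊕ V × V) :
    ‖optimalFlow G Θ c s r p‖ ≤ 1 + K ^ 2 * (2 * B) := by
  have hK : 0 ≤ K := (abs_nonneg c).trans hc
  have hV : Nonempty V := by
    by_contra h
    rw [not_nonempty_iff] at h
    simpa using hr.2
  have hB : 0 ≤ B := (abs_nonneg _).trans (hs (Classical.arbitrary V))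
  have h0 : 0 ≤ K ^ 2 * (2 * B) := by positivity
  rcases p with i | ⟨i, j⟩
  · have : ‖r i‖ ≤ 1 := by
      rw [Real.norm_eq_abs, abs_of_nonneg (hr.1 i)]
      exact le_one_of_mem_stdSimplex hr i
    exact this.trans (by linarith)
  · change ‖if G.Adj i j then -(c ^ 2 * (s i - s j)) * Θ (r i) (r j) else 0‖ ≤ _
    split_ifs
    · have h1 : |s i - s j| ≤ 2 * B := (abs_sub _ _).trans (by linarith [hs i, hs j])
      have h2 : c ^ 2 ≤ K ^ 2 := by
        rw [← sq_abs c]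
        exact pow_le_pow_left₀ (abs_nonneg _) hc 2
      have h3 : |Θ (r i) (r j)| ≤ 1 := by
        rw [abs_of_nonneg (hΘ.nonneg (hr.1 i) (hr.1 j))]
        exact hΘ.le_one (hr.1 i) (hr.1 j) (le_one_of_mem_stdSimplex hr i)
          (le_one_of_mem_stdSimplex hr j)
      rw [Real.norm_eq_abs, abs_mul, abs_neg, abs_mul, abs_of_nonneg (sq_nonneg c)]
      calc c ^ 2 * |s i - s j| * |Θ (r i) (r j)| ≤ K ^ 2 * (2 * B) * 1 := by gcongr
        _ ≤ 1 + K ^ 2 * (2 * B) := by linarith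
    · rw [norm_zero]
      linarith

end Strong

/-! ### Strong duality for a deterministic speed -/

section Duality

variable {V : Type*} [Fintype V] (G : SimpleGraph V) [DecidableRel G.Adj]

/-- A pair satisfying the Lagrangian lower bound yields, up to a small loss, an admissible
potential. -/
theorem exists_dualValue_of_lagrangian_bound [Nonempty V] {Θ : ℝ → ℝ → ℝ} (hΘ : IsProbWeight Θ)
    {wdot : ℝ → ℝ} (hc : IsRegularSpeed fun t => 1 + wdot t) {ρa ρb : V → ℝ}
    (ha : ρa ∈ stdSimplex ℝ V) (hb : ρb ∈ stdSimplex ℝ V) {S S' : V → ℝ → ℝ}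
    (hS : ∀ i, IsPrimitive (S i) (S' i) ∧ Continuous (S i) ∧
      MemLp (S' i) 2 unitVolume ∧ Measurable (S' i)) {b ε : ℝ} (hε : 0 < ε)
    (hbound : ∀ x : ℝ → FlowSpace V, MemLp x 2 unitVolume →
      ∫⁻ t, flowIntegrand G Θ (fun t => 1 + wdot t) t (x t) ∂unitVolume ≠ ⊤ →
      b ≤ ∑ i, (S i 1 * ρb i - S i 0 * ρa i)
        + ∫ t, ∑ i, (S i t * fluxDiv G i (x t) - S' i t * densityCoord i (x t)) ∂unitVolume
        + (∫⁻ t, flowIntegrand G Θ (fun t => 1 + wdot t) t (x t) ∂unitVolume).toReal) :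
    ∃ v ∈ dualValues G Θ wdot ρa ρb, b - ε ≤ v := by
  have hwm : Measurable wdot := by
    have := hc.measurable.sub_const 1
    simpa using this
  obtain ⟨K, hK⟩ := hc.upper
  have hSb : ∃ B, ∀ t ∈ Icc (0 : ℝ) 1, ∀ i, |S i t| ≤ B := by
    choose C hC using fun i => (hS i).1.exists_bound
    refine ⟨∑ i, |C i|, fun t ht i => (hC i t ht).trans ((le_abs_self _).trans ?_)⟩
    exact Finset.single_le_sum (f := fun i => |C i|) (fun j _ => abs_nonneg _) (Finset.mem_univ i)
  obtain ⟨B, hB⟩ := hSb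
  obtain ⟨h, hhm, hlub, r, hrm, hr, hsel⟩ := exists_isLUB_and_selection G hΘ hwm
    (fun i => (hS i).2.2.2) (fun i => (hS i).2.1.measurable) hε
  set H : ℝ → (V → ℝ) → ℝ :=
    fun t => hamiltonJacobi G Θ (wdot t) (fun i => S' i t) (fun i => S i t) with hH
  set C : ℝ := (1 / 4) * ∑ _i : V, ∑ _j : V, (2 * B) ^ 2 * 1 * K ^ 2 with hC
  have hHbound : ∀ t ∈ Icc (0 : ℝ) 1, ∀ q ∈ stdSimplex ℝ V, |H t q| ≤ ∑ i, |S' i t| + C :=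
    fun t ht q hq => abs_hamiltonJacobi_le G hΘ (hK t ht) _ (hB t ht) hq
  have hmajor : MemLp (fun t => ∑ i, |S' i t| + C) 2 unitVolume :=
    (memLp_finsetSum _ fun i _ => (hS i).2.2.1.abs).add (memLp_const C)
  have hhbound : ∀ t ∈ Icc (0 : ℝ) 1, |h t| ≤ ∑ i, |S' i t| + C := by
    intro t ht
    rw [abs_le]
    constructor
    · exact (abs_le.1 (hHbound t ht _ (hr t))).1.trans ((hlub t).1 (mem_image_of_mem _ (hr t)))
    · refine (hlub t).2 ?_
      rintro _ ⟨q, hq, rfl⟩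
      exact (le_abs_self _).trans (hHbound t ht q hq)
  have hhLp : MemLp h 2 unitVolume := by
    refine hmajor.of_le hhm.aestronglyMeasurable ?_
    filter_upwards [ae_restrict_mem measurableSet_Icc] with t ht
    exact (hhbound t ht).trans (le_abs_self _)
  have hhint := integrable_of_memLp hhLp
  -- Subtracting ∫₀ᵗ h lowers the Hamiltonian at each time by its maximum h(t), so the new maximum
  -- is exactly zero.
  refine ⟨_, ⟨fun t i => S i t - ∫ s in (0 : ℝ)..t, h s, fun t i => S' i t - h t,
    ⟨?_, ?_⟩, rfl⟩, ?_⟩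
  · refine hasH1Deriv_of_isPrimitive (fun i => ⟨(hS i).1.integrable.sub hhint, fun t ht => ?_⟩)
      fun i => (hS i).2.2.1.sub hhLp
    rw [intervalIntegral.integral_sub
      (intervalIntegrable_of_integrable (hS i).1.integrable (by simp) ht)
      (intervalIntegrable_of_integrable hhint (by simp) ht), intervalIntegral.integral_same,
      (hS i).1.eq_integral t ht]
    ring
  · refine ae_of_all _ fun t => ?_
    have himage : hamiltonJacobi G Θ (wdot t) (fun i => S' i t - h t)
        (fun i => S i t - ∫ s in (0 : ℝ)..t, h s) '' stdSimplex ℝ V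
        = (fun y => y - h t) '' (H t '' stdSimplex ℝ V) := by
      rw [image_image]
      exact image_congr fun q hq => hamiltonJacobi_sub G Θ _ _ _ _ _ hq
    change IsLUB (hamiltonJacobi G Θ (wdot t) (fun i => S' i t - h t)
        (fun i => S i t - ∫ s in (0 : ℝ)..t, h s) '' stdSimplex ℝ V) 0
    rw [himage]
    constructor
    · rintro _ ⟨y, hy, rfl⟩
      exact sub_nonpos.2 ((hlub t).1 hy)
    · intro u hu
      have : h t ≤ u + h t := (hlub t).2 fun y hy => by
        have := hu (mem_image_of_mem _ hy)
        linarith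
      linarith
  set x : ℝ → FlowSpace V := fun t => optimalFlow G Θ (1 + wdot t) (fun i => S i t) (r t) with hx
  have hxm : Measurable x := measurable_optimalFlow G hΘ hc.measurable
    (fun i => (hS i).2.1.measurable) hrm hr
  have hxLp : MemLp x 2 unitVolume := by
    refine memLp_piLp_iff.2 fun p => MemLp.of_bound ?_ (1 + K ^ 2 * (2 * B)) ?_
    · exact ((EuclideanSpace.proj (𝕜 := ℝ) p).continuous.measurable.comp hxm).aestronglyMeasurable
    · filter_upwards [ae_restrict_mem measurableSet_Icc] with t ht
      exact norm_optimalFlow_coord_le G hΘ (hK t ht) (hB t ht) (hr t) p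
  set e : ℝ → ℝ := fun t => (1 / 4) * ∑ i, ∑ j ∈ G.neighborFinset i,
    (S i t - S j t) ^ 2 * Θ (r t i) (r t j) * (1 + wdot t) ^ 2 with he
  have he0 : ∀ t, 0 ≤ e t := fun t => mul_nonneg (by norm_num) (Finset.sum_nonneg fun i _ =>
    Finset.sum_nonneg fun j _ => by
      have := hΘ.nonneg ((hr t).1 i) ((hr t).1 j)
      positivity)
  have hHe : ∀ t, H t (r t) = ∑ i, S' i t * r t i + e t := fun t => rfl
  have hxe : ∀ t, ∑ i, (S i t * fluxDiv G i (x t) - S' i t * densityCoord i (x t))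
      = - 2 * e t - ∑ i, S' i t * r t i := by
    intro t
    rw [Finset.sum_sub_distrib, hx,
      sum_mul_fluxDiv_optimalFlow G hΘ (1 + wdot t) (fun i => S i t) (hr t), he]
    simp only [densityCoord_optimalFlow]
    ring
  have hint1 : ∀ i, Integrable (fun t => S' i t * densityCoord i (x t)) unitVolume := fun i =>
    (hS i).2.2.1.integrable_mul ((densityCoord i).comp_memLp' hxLp)
  have hint2 : ∀ i, Integrable (fun t => S i t * fluxDiv G i (x t)) unitVolume := fun i =>
    (hS i).1.integrable_mul (integrable_of_memLp ((fluxDiv G i).comp_memLp' hxLp))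
  have hint3 : Integrable (fun t => - 2 * e t - ∑ i, S' i t * r t i) unitVolume := by
    have := integrable_finsetSum Finset.univ fun i _ => (hint2 i).sub (hint1 i)
    refine this.congr (ae_of_all _ fun t => ?_)
    exact hxe t
  have hint4 : Integrable (fun t => ∑ i, S' i t * r t i) unitVolume :=
    integrable_finsetSum Finset.univ fun i _ => hint1 i
  have hinte : Integrable e unitVolume := by
    have := (hint3.add hint4).const_mul (-(1 / 2))
    refine this.congr (ae_of_all _ fun t => ?_)
    simp only [Pi.add_apply]
    ring
  have henergy : ∫⁻ t, flowIntegrand G Θ (fun t => 1 + wdot t) t (x t) ∂unitVolume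
      = ENNReal.ofReal (∫ t, e t ∂unitVolume) := by
    rw [ofReal_integral_eq_lintegral_ofReal hinte (ae_of_all _ he0)]
    refine lintegral_congr_ae ?_
    filter_upwards [ae_restrict_mem measurableSet_Icc] with t ht
    exact flowIntegrand_optimalFlow G hΘ (c := fun t => 1 + wdot t) (hc.ne_zero ht) _ (hr t)
  have hmain := hbound x hxLp (by rw [henergy]; exact ENNReal.ofReal_ne_top)
  rw [henergy, ENNReal.toReal_ofReal (integral_nonneg he0), add_assoc] at hmain
  simp only [hxe] at hmain
  rw [← integral_add hint3 hinte] at hmain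
  -- The pairing contributes -2e - Σ S'_i r_i and the energy contributes e, so the integrand is
  -- minus the Hamiltonian at r(t), which is at most ε - h(t) by the selection.
  have hcomp : ∫ t, (- 2 * e t - ∑ i, S' i t * r t i + e t) ∂unitVolume
      ≤ ∫ t, (ε - h t) ∂unitVolume := by
    refine integral_mono (hint3.add hinte) ((integrable_const ε).sub hhint) fun t => ?_
    have h1 := hsel t
    have h2 := hHe t
    simp only [hH] at h2
    simp only
    linarith
  rw [integral_sub (integrable_const ε) hhint, integral_const, probReal_univ, one_smul,
    integral_unitVolume h] at hcomp
  have hvalue : ∑ i, (S i 1 - ∫ s in (0 : ℝ)..1, h s) * ρb i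
      - ∑ i, (S i 0 - ∫ s in (0 : ℝ)..0, h s) * ρa i
      = ∑ i, (S i 1 * ρb i - S i 0 * ρa i) - ∫ s in (0 : ℝ)..1, h s := by
    simp only [sub_mul, Finset.sum_sub_distrib, ← Finset.mul_sum, ha.2, hb.2,
      intervalIntegral.integral_same]
    ring
  rw [hvalue]
  linarith

/-- Existence of minimizers and duality for a deterministic speed. -/
theorem isLeast_action_and_isLUB_dual (hG : G.Connected) {Θ : ℝ → ℝ → ℝ} (hΘ : IsProbWeight Θ)
    {wdot : ℝ → ℝ} (hc : IsRegularSpeed fun t => 1 + wdot t) {ρa ρb : V → ℝ}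
    (ha : ρa ∈ stdSimplex ℝ V) (hb : ρb ∈ stdSimplex ℝ V) :
    ∃ a : ℝ≥0, IsLeast (actionValues G Θ wdot ρa ρb) (a : ℝ≥0∞) ∧
      IsLUB (dualValues G Θ wdot ρa ρb) (a : ℝ) := by
  have := hG.nonempty
  obtain ⟨K, hK⟩ := hc.upper
  have hint := isCoerciveIntegrand_flowIntegrand G hΘ hc.measurable (fun t ht => hc.ne_zero ht) hK
  obtain ⟨a, ⟨x, hx, hxa⟩, hdual⟩ := exists_min_control_and_dual hint densityCoord (fluxDiv G) ρa ρb
    (exists_controlled_finite_energy G hG hΘ hc ha hb)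
  obtain ⟨ρ, m, hfeas, hact⟩ := exists_feasible_of_controlled G hc hx (by rw [hxa]; simp)
    (hint.aemeasurable hx.memLp.aestronglyMeasurable)
  rw [hxa] at hact
  have happrox : ∀ ε > 0, ∃ v ∈ dualValues G Θ wdot ρa ρb, (a : ℝ) - ε ≤ v := by
    intro ε hε
    -- One half of ε is lost in the separation, the other in the selection of near-maximizers.
    obtain ⟨S, S', hS, hbound⟩ := hdual (ε / 2) (by positivity)
    obtain ⟨v, hv, hle⟩ := exists_dualValue_of_lagrangian_bound G hΘ hc ha hb hS
      (half_pos hε) hbound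
    exact ⟨v, hv, by linarith⟩
  refine ⟨a, ⟨⟨ρ, m, hfeas, hact.symm⟩, ?_⟩, ?_, fun u hu => ?_⟩
  · rintro _ ⟨ρ₁, m₁, hfeas₁, rfl⟩
    refine ENNReal.le_of_forall_pos_le_add fun ε hε _ => ?_
    obtain ⟨v, ⟨S, S', hS, rfl⟩, hle⟩ := happrox ε hε
    have hweak := ofReal_dual_le_action G hfeas₁ hS
    calc (a : ℝ≥0∞) = ENNReal.ofReal (a : ℝ) := (ENNReal.ofReal_coe_nnreal).symm
      _ ≤ ENNReal.ofReal ((∑ i, S 1 i * ρb i - ∑ i, S 0 i * ρa i) + ε) :=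
          ENNReal.ofReal_le_ofReal (by linarith)
      _ ≤ ENNReal.ofReal (∑ i, S 1 i * ρb i - ∑ i, S 0 i * ρa i) + ENNReal.ofReal ε :=
          ENNReal.ofReal_add_le
      _ ≤ action G Θ ρ₁ m₁ + ε := by
          rw [ENNReal.ofReal_coe_nnreal]
          gcongr
  · rintro _ ⟨S, S', hS, rfl⟩
    have hweak := ofReal_dual_le_action G hfeas hS
    rw [hact, ← ENNReal.ofReal_coe_nnreal, ENNReal.ofReal_le_ofReal_iff a.coe_nonneg] at hweak
    exact hweak
  · refine le_of_forall_pos_le_add fun ε hε => ?_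
    obtain ⟨v, hv, hle⟩ := happrox ε hε
    linarith [hu hv]

end Duality

/-! ### Regularity of the Brownian speed -/

theorem measurable_wongZakaiDeriv (w : ℝ≥0 → ℝ) (δ : ℝ≥0) : Measurable (wongZakaiDeriv w δ) := by
  have h : Measurable fun t : ℝ => ⌊t / (δ : ℝ)⌋₊ :=
    Nat.measurable_floor.comp (measurable_id.div_const _)
  exact (measurable_from_nat (f := fun k : ℕ => (w ((k + 1) * δ) - w (k * δ)) / (δ : ℝ))).comp h

theorem isRegularSpeed_wongZakaiDeriv {w : ℝ≥0 → ℝ} {δ : ℝ≥0}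
    (hw : ∀ k : ℕ, 1 + (w ((k + 1) * δ) - w (k * δ)) / (δ : ℝ) ≠ 0) :
    IsRegularSpeed fun t => 1 + wongZakaiDeriv w δ t := by
  set F : ℕ → ℝ := fun k => |1 + (w ((k + 1) * δ) - w (k * δ)) / (δ : ℝ)| with hF
  -- The grid indices met on [0,1] run up to ⌊1/δ⌋ inclusive, because t = 1 counts; extrema over
  -- this finite set give the two bounds.
  set s : Finset ℕ := Finset.range (⌊(1 : ℝ) / δ⌋₊ + 1) with hs
  have hsne : s.Nonempty := ⟨0, by simp [hs]⟩
  have hmem : ∀ t ∈ Icc (0 : ℝ) 1, ⌊t / (δ : ℝ)⌋₊ ∈ s := by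
    intro t ht
    rw [hs, Finset.mem_range, Nat.lt_succ_iff]
    exact Nat.floor_le_floor (div_le_div_of_nonneg_right ht.2 δ.coe_nonneg)
  refine ⟨(measurable_wongZakaiDeriv w δ).const_add 1, ?_, ?_⟩
  · obtain ⟨k, -, hk⟩ := s.exists_min_image F hsne
    exact ⟨F k, abs_pos.2 (hw k), fun t ht => hk _ (hmem t ht)⟩
  · obtain ⟨k, -, hk⟩ := s.exists_max_image F hsne
    exact ⟨F k, fun t ht => hk _ (hmem t ht)⟩

/-- Almost surely, no difference quotient of a Brownian motion over the grid equals `-1`. -/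
theorem ae_one_add_quotient_ne_zero {Ω : Type*} [MeasurableSpace Ω] {P : Measure Ω}
    {W : ℝ≥0 → Ω → ℝ} (hW : IsPreBrownianReal W P) {δ : ℝ≥0} (hδ : 0 < δ) :
    ∀ᵐ ω ∂P, ∀ k : ℕ, 1 + (W ((k + 1) * δ) ω - W (k * δ) ω) / (δ : ℝ) ≠ 0 := by
  refine ae_all_iff.2 fun k => ?_
  have hlaw := hW.hasLaw_sub ((k + 1) * δ) (k * δ)
  have hδ' : (δ : ℝ) ≠ 0 := by exact_mod_cast hδ.ne'
  -- The variance of the increment is the grid step, and positivity of the step is what rules out an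
  -- atom at -δ.
  have hvar : nndist (((k + 1) * δ : ℝ≥0) : ℝ) ((k * δ : ℝ≥0) : ℝ) ≠ 0 := by
    rw [Ne, nndist_eq_zero]
    push_cast
    intro h
    apply hδ'
    linarith
  have : NullSingletonClass
      (gaussianReal 0 (nndist ((k + 1) * δ : ℝ≥0).1 ((k : ℝ≥0) * δ : ℝ≥0).1)) :=
    nullSingletonClass_gaussianReal hvar
  have h : ∀ᵐ ω ∂P, (W ((k + 1) * δ) - W (k * δ)) ω ≠ -(δ : ℝ) := by
    refine (hlaw.ae_iff (p := fun y => y ≠ -(δ : ℝ)) ?_).2 ?_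
    · exact (measurableSet_singleton (-(δ : ℝ))).compl.mem
    · exact Measure.ae_ne _ _
  filter_upwards [h] with ω hω h0
  apply hω
  rw [Pi.sub_apply]
  field_simp at h0
  linarith

end GraphOT

theorem mainTheorem9 {V : Type*} [Fintype V] (G : SimpleGraph V) [DecidableRel G.Adj]
    (hG : G.Connected) (Θ : ℝ → ℝ → ℝ) (hΘ : GraphOT.IsProbWeight Θ)
    {Ω : Type*} [MeasurableSpace Ω] (P : Measure Ω) [IsProbabilityMeasure P]
    (W : ℝ≥0 → Ω → ℝ) (hW : IsBrownianReal W P) (δ : ℝ≥0) (hδ : 0 < δ) :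
    ∀ᵐ ω ∂P, ∀ ρa ∈ stdSimplex ℝ V, ∀ ρb ∈ stdSimplex ℝ V, ∃ a : ℝ≥0,
      IsLeast (GraphOT.actionValues G Θ (GraphOT.wongZakaiDeriv (W · ω) δ) ρa ρb) (a : ℝ≥0∞) ∧
      IsLUB (GraphOT.dualValues G Θ (GraphOT.wongZakaiDeriv (W · ω) δ) ρa ρb) (a : ℝ) := by
  filter_upwards [GraphOT.ae_one_add_quotient_ne_zero hW.toIsPreBrownianReal hδ] with ω hω
  intro ρa ha ρb hb
  exact GraphOT.isLeast_action_and_isLUB_dual G hG hΘ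
    (GraphOT.isRegularSpeed_wongZakaiDeriv (w := fun t => W t ω) hω) ha hb
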